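/- Let $H_S$ be a Hermitian operator on $\mathbb{C}^2$ with eigenvalue gap $\Delta>0$. Let the environment be one qubit with Hamiltonian $H_E=\mathrm{diag}(0,\gamma)$, put $H=H_S\otimes 1+1\otimes H_E$, and for a Hamiltonian $K$ write $\rho_K(\beta)=e^{-\beta K}/\mathrm{Tr}\,e^{-\beta K}$. Let $$\Phi(\rho)=\mathrm{Tr}_E\,\mathbb{E}_G\!\left[e^{+i(H+\alpha G)t}\,\big(\rho\otimes\rho_{H_E}(\beta)\big)\,e^{-i(H+\alpha G)t}\right],$$ where $G=UDU^\dagger$ with $U$ a Haar random unitary on $\mathbb{C}^2\otimes\mathbb{C}^2$ and $D$ an independent diagonal matrix with i.i.d. $\mathcal N(0,1)$ entries. For $\sigma>0$, $\varepsilon>0$ and a window $[\gamma-\sigma,\gamma+\sigma]$ containing $\Delta$ (that is, $|\Delta-\gamma|\le\sigma$), put $$\alpha=\frac{1}{t^3(\Delta+\sigma)^2},\qquad t_\pm=\frac1\sigma\sqrt{1\pm\sqrt{1-\frac{2\sigma^2}{\Delta^2\varepsilon}}},$$ $$L=\left\lceil\frac{10}{\alpha^2t^2(1-\sigma^2t^2/2)}\left(2\log\frac{5}{\alpha^2t^2\,\mathrm{sinc}^2(|\Delta-\gamma|t/2)}+4(1+\log2)-\frac12+\log\frac2\varepsilon\right)\right\rceil,$$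 where $\mathrm{sinc}\,x=\sin x/x$ and $\mathrm{sinc}\,0=1$; the value of $L$ is read as $0$ if the expression inside the ceiling is negative. There are universal constants $C>0$ and $k\in\mathbb{N}$ such that the following two statements hold. (1) For every such $H_S$, every density matrix $\rho$ with $[\rho,H_S]=0$, all $\beta\ge0$, $\varepsilon>0$, $\sigma>0$ with $$\sigma\le\min\left\{\frac{\varepsilon}{2\beta},\ \Delta\sqrt{\frac{\varepsilon}{2}}\right\}$$ (where $\varepsilon/(2\beta)=\infty$ if $\beta=0$), every $\gamma$ with $|\Delta-\gamma|\le\sigma$ and every $t\in[t_-,t_+]$, $$\big\|\rho_{H_S}(\beta)-\Phi^{\circ L}(\rho)\big\|_1\le C\,\varepsilon\,(1+|\log\varepsilon|)^k ,$$ where $\|\cdot\|_1$ is the trace norm; that is, the error is $\widetilde O(\varepsilon)$. (2) For all $\Delta>0$ and $0<\varepsilon\le2$ and for all sufficiently small $\sigma>0$ (depending on $\Delta,\varepsilon$), the choice $t=t_-$ satisfies, for every $\gamma$ with $|\Delta-\gamma|\le\sigma$, $$L\cdot t\le\frac{C\,(1+|\log\varepsilon|)^k}{\Delta\,\varepsilon^{2.5}}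 ;$$ that is, as $\sigma\to0$ the total simulation time is $\widetilde O\!\left(1/(\Delta\varepsilon^{2.5})\right)$, with a bound independent of $\beta$. -/

import Mathlib

open MeasureTheory ProbabilityTheory Filter Topology
open scoped Matrix Kronecker ComplexOrder

noncomputable section

namespace Thermalization

variable {n m : Type*} [Fintype n] [DecidableEq n] [Fintype m] [DecidableEq m]

/-! ### Haar measure on the unitary group -/

/-- The unitary group carries its Borel sigma-algebra. -/
instance unitaryMeasurableSpace : MeasurableSpace (Matrix.unitaryGroup n ℂ) := borel _

instance unitaryBorelSpace : BorelSpace (Matrix.unitaryGroup n ℂ) := ⟨rfl⟩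

/-- The unitary group is compact: it is a closed subset of a product of closed discs. -/
instance unitaryCompactSpace : CompactSpace (Matrix.unitaryGroup n ℂ) := by
  suffices h : IsCompact (Matrix.unitaryGroup n ℂ : Set (Matrix n n ℂ)) from
    isCompact_iff_compactSpace.mp h
  have hK : IsCompact {A : Matrix n n ℂ | ∀ i, A i ∈ {v : n → ℂ | ∀ j, v j ∈ Metric.closedBall 0 1}} :=
    isCompact_pi_infinite fun _ => isCompact_pi_infinite fun _ => isCompact_closedBall 0 1
  refine hK.of_isClosed_subset isClosed_unitary fun A hA i j => ?_
  simpa using entry_norm_bound_of_unitary hA i j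

/-- The Haar probability measure on the unitary group. -/
def haarUnitary (n : Type*) [Fintype n] [DecidableEq n] : Measure (Matrix.unitaryGroup n ℂ) :=
  Measure.haarMeasure ⊤

/-- The joint law of Haar distributed eigenvectors `U` and of independent, i.i.d. standard normal
eigenvalues `d`. -/
def interactionLaw (n : Type*) [Fintype n] [DecidableEq n] :
    Measure (Matrix.unitaryGroup n ℂ × (n → ℝ)) :=
  (haarUnitary n).prod (Measure.pi fun _ => gaussianReal 0 1)

/-- The random interaction `G = U D U†`. -/
def interaction (p : Matrix.unitaryGroup n ℂ × (n → ℝ)) : Matrix n n ℂ :=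
  (p.1 : Matrix n n ℂ) * Matrix.diagonal (fun i => (p.2 i : ℂ)) * (p.1 : Matrix n n ℂ)ᴴ

/-! ### States, partial trace, trace norm -/

/-- Density matrices: positive semidefinite of unit trace. -/
def IsDensityMatrix (ρ : Matrix n n ℂ) : Prop := ρ.PosSemidef ∧ ρ.trace = 1

/-- The thermal state `e^{-βH} / Tr e^{-βH}`. -/
def gibbs (H : Matrix n n ℂ) (β : ℝ) : Matrix n n ℂ :=
  (NormedSpace.exp (-(β : ℂ) • H)).trace⁻¹ • NormedSpace.exp (-(β : ℂ) • H)

/-- The partial trace over the second tensor factor. -/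
def partialTraceEnv (X : Matrix (n × m) (n × m) ℂ) : Matrix n n ℂ :=
  Matrix.of fun i j => ∑ k, X (i, k) (j, k)

/-- The trace norm (Schatten 1-norm): the sum of the singular values, that is, of the square roots
of the eigenvalues of `A† A`. -/
def traceNorm (A : Matrix n n ℂ) : ℝ :=
  ∑ i, √((Matrix.isHermitian_conjTranspose_mul_self A).eigenvalues i)

/-! ### The thermalizing channel -/

/-- The uncoupled Hamiltonian `H_S ⊗ 1 + 1 ⊗ H_E`. -/
def totalHamiltonian (HS : Matrix n n ℂ) (HE : Matrix m m ℂ) : Matrix (n × m) (n × m) ℂ :=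
  HS ⊗ₖ (1 : Matrix m m ℂ) + (1 : Matrix n n ℂ) ⊗ₖ HE

/-- Evolution with a fixed interaction: `e^{+i(H + αG)t} X e^{-i(H + αG)t}`. -/
def evolve (H G : Matrix n n ℂ) (α t : ℝ) (X : Matrix n n ℂ) : Matrix n n ℂ :=
  NormedSpace.exp ((Complex.I * t) • (H + (α : ℂ) • G)) * X *
    NormedSpace.exp (-(Complex.I * t) • (H + (α : ℂ) • G))

/-- The thermalizing channel
`Φ(ρ) = Tr_E E_G [e^{+i(H + αG)t} (ρ ⊗ ρ_E(β)) e^{-i(H + αG)t}]`, the expectation over the random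
interaction being taken entry by entry. -/
def channel (HS : Matrix n n ℂ) (HE : Matrix m m ℂ) (α β t : ℝ) (ρ : Matrix n n ℂ) :
    Matrix n n ℂ :=
  partialTraceEnv <| Matrix.of fun a b =>
    ∫ p, evolve (totalHamiltonian HS HE) (interaction p) α t (ρ ⊗ₖ gibbs HE β) a b
      ∂(interactionLaw (n × m))

/-- The environment qubit with gap `γ`: `H_E = diag(0, γ)`. -/
def envHamiltonian (γ : ℝ) : Matrix (Fin 2) (Fin 2) ℂ := !![0, 0; 0, (γ : ℂ)]

/-! ### Single-qubit systems and the parameter choices -/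

/-- The eigenvalue gap of a single-qubit Hamiltonian. -/
def qubitGap {HS : Matrix (Fin 2) (Fin 2) ℂ} (hHS : HS.IsHermitian) : ℝ :=
  |hHS.eigenvalues 0 - hHS.eigenvalues 1|

/-- The coupling constant `α = 1 / (t³ (Δ + σ)²)`. -/
def coupling (Δ σ t : ℝ) : ℝ := 1 / (t ^ 3 * (Δ + σ) ^ 2)

/-- The lower end of the window of interaction times. -/
def timeLower (Δ σ ε : ℝ) : ℝ := 1 / σ * √(1 - √(1 - 2 * σ ^ 2 / (Δ ^ 2 * ε)))

/-- The upper end of the window of interaction times. -/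
def timeUpper (Δ σ ε : ℝ) : ℝ := 1 / σ * √(1 + √(1 - 2 * σ ^ 2 / (Δ ^ 2 * ε)))

/-- The number of interactions. -/
def numInteractions (Δ γ σ ε t : ℝ) : ℕ :=
  ⌈10 / (coupling Δ σ t ^ 2 * t ^ 2 * (1 - σ ^ 2 * t ^ 2 / 2)) *
    (2 * Real.log (5 / (coupling Δ σ t ^ 2 * t ^ 2 * Real.sinc (|Δ - γ| * t / 2) ^ 2))
      + 4 * (1 + Real.log 2) - 1 / 2 + Real.log (2 / ε))⌉₊

end Thermalization

end

open Thermalization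

/-!
Averaging over the Haar unitary makes the interaction invariant under conjugation by diagonal
phases, so in the eigenbasis of `H` the averaged evolution kills all coherences and acts on the
populations by the doubly stochastic matrix of the averaged transition probabilities
`E |⟨a| exp (i (H + αG) t) |b⟩|²`. The transition amplitude is, up to an error `O(α² t² ‖G‖²)`,
the first-order term `i α G_ab φ` with `|φ| = t |sinc (ω t / 2)|`, where `ω` is the difference of
the two levels; and `E |G_ab|² = 1 / (d + 1)` for `a ≠ b` in dimension `d`.

Inside the window of times, `αt ≤ ε` and `1 ≤ Δ² ε t²`. Hence the resonant transition
`|1⟩|0⟩ ↔ |0⟩|1⟩`, detuned by `Δ - γ` only, has probability of order `(αt)²`, while all others,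
whose level differences are at least `Δ / 2`, have probability `(αt)² O(ε)`. Double stochasticity
forces the two resonant probabilities to agree up to `(αt)² O(ε)`. So the populations of the qubit
form a two-level Markov chain that satisfies detailed balance with respect to the Gibbs weights of
the environment up to `(αt)² O(ε)` and contracts at rate of order `(αt)²`: it converges to these
weights up to `O(ε)`, and `L` interactions suffice. The Gibbs weights of the environment and of the
system differ by at most `β |Δ - γ| ≤ ε / 2`, the logistic function being 1-Lipschitz. For `ε`
bounded away from zero the trivial bound `2` on the trace distance is enough.
-/

noncomputable section

namespace Thermalization

section DiagonalMatrices

variable {n : Type*} [DecidableEq n]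

/-- The diagonal matrix with real diagonal `x`: a Hamiltonian in its eigenbasis, or a state that
commutes with it. -/
def realDiagonal (x : n → ℝ) : Matrix n n ℂ := Matrix.diagonal fun i => (x i : ℂ)

lemma realDiagonal_apply (x : n → ℝ) (i j : n) :
    realDiagonal x i j = if i = j then (x i : ℂ) else 0 :=
  Matrix.diagonal_apply _ _ _

lemma mul_realDiagonal_apply [Fintype n] (M : Matrix n n ℂ) (x : n → ℝ) (i j : n) :
    (M * realDiagonal x) i j = M i j * x j :=
  Matrix.mul_diagonal _ _ _ _

lemma isHermitian_realDiagonal (x : n → ℝ) : (realDiagonal x).IsHermitian := by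
  simp [realDiagonal, Matrix.IsHermitian, Matrix.diagonal_conjTranspose, Pi.star_def]

lemma realDiagonal_neg (x : n → ℝ) : realDiagonal (-x) = -realDiagonal x := by
  simp [realDiagonal, Matrix.diagonal_neg]

lemma realDiagonal_sub (x y : n → ℝ) :
    realDiagonal (x - y) = realDiagonal x - realDiagonal y := by
  simp [realDiagonal, Matrix.diagonal_sub]

lemma diagonal_mem_unitaryGroup [Fintype n] {v : n → ℂ} (hv : ∀ i, ‖v i‖ = 1) :
    Matrix.diagonal v ∈ Matrix.unitaryGroup n ℂ := by
  rw [Matrix.mem_unitaryGroup_iff, Matrix.star_eq_conjTranspose, Matrix.diagonal_conjTranspose,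
    Matrix.diagonal_mul_diagonal, ← Matrix.diagonal_one]
  congr 1 with i
  simp [Complex.mul_conj', hv]

end DiagonalMatrices

/-! ### Perturbation theory of the propagator -/

section Propagator

open scoped Matrix.Norms.L2Operator

variable {n : Type*} [Fintype n] [DecidableEq n]

/-- The unitary `e^{iAt}` generated by `A`. -/
def propagator (A : Matrix n n ℂ) (t : ℝ) : Matrix n n ℂ :=
  NormedSpace.exp ((Complex.I * t) • A)

/-- The evolution `e^{-iHt} e^{i(H + V)t}` of the interaction picture. -/
def interactionPicture (H V : Matrix n n ℂ) (t : ℝ) : Matrix n n ℂ :=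
  propagator (-H) t * propagator (H + V) t

lemma propagator_eq_exp_smul (A : Matrix n n ℂ) (t : ℝ) :
    propagator A t = NormedSpace.exp (t • (Complex.I • A)) := by
  rw [propagator, ← Complex.coe_smul, smul_smul, mul_comm]

@[simp] lemma propagator_zero (A : Matrix n n ℂ) : propagator A 0 = 1 := by
  simp [propagator]

lemma propagator_neg_mul_self (A : Matrix n n ℂ) (t : ℝ) :
    propagator (-A) t * propagator A t = 1 := by
  rw [propagator, propagator, smul_neg,
    ← Matrix.exp_add_of_commute _ _ (Commute.refl ((Complex.I * (t : ℂ)) • A)).neg_left]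
  simp

lemma conjTranspose_propagator {A : Matrix n n ℂ} (hA : A.IsHermitian) (t : ℝ) :
    (propagator A t)ᴴ = propagator (-A) t := by
  rw [propagator, ← Matrix.exp_conjTranspose, Matrix.conjTranspose_smul, hA.eq]
  simp [propagator]

lemma propagator_mem_unitaryGroup {A : Matrix n n ℂ} (hA : A.IsHermitian) (t : ℝ) :
    propagator A t ∈ Matrix.unitaryGroup n ℂ := by
  rw [Matrix.mem_unitaryGroup_iff', Matrix.star_eq_conjTranspose, conjTranspose_propagator hA,
    propagator_neg_mul_self]

lemma propagator_realDiagonal (E : n → ℝ) (t : ℝ) :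
    propagator (realDiagonal E) t = Matrix.diagonal fun i => Complex.exp (Complex.I * t * E i) := by
  rw [propagator, realDiagonal, ← Matrix.diagonal_smul, Matrix.exp_diagonal]
  congr 1 with i
  rw [Pi.coe_exp, ← Complex.exp_eq_exp_ℂ, Pi.smul_apply, smul_eq_mul]

lemma hasDerivAt_propagator (A : Matrix n n ℂ) (t : ℝ) :
    HasDerivAt (propagator A) ((Complex.I • A) * propagator A t) t := by
  rw [funext (propagator_eq_exp_smul A)]
  exact hasDerivAt_exp_smul_const' (𝕂 := ℝ) (Complex.I • A) t

lemma hasDerivAt_propagator' (A : Matrix n n ℂ) (t : ℝ) :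
    HasDerivAt (propagator A) (propagator A t * (Complex.I • A)) t := by
  rw [funext (propagator_eq_exp_smul A)]
  exact hasDerivAt_exp_smul_const (𝕂 := ℝ) (Complex.I • A) t

lemma hasDerivAt_interactionPicture (H V : Matrix n n ℂ) (t : ℝ) :
    HasDerivAt (interactionPicture H V)
      (propagator (-H) t * (Complex.I • V) * propagator (H + V) t) t := by
  refine ((hasDerivAt_propagator' (-H) t).mul (hasDerivAt_propagator (H + V) t)).congr_deriv ?_
  simp only [smul_add, smul_neg, mul_neg, neg_mul, add_mul, mul_add, mul_assoc]
  abel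

@[simp] lemma interactionPicture_zero (H V : Matrix n n ℂ) : interactionPicture H V 0 = 1 := by
  simp [interactionPicture]

lemma norm_le_one_of_mem_unitaryGroup {U : Matrix n n ℂ} (hU : U ∈ Matrix.unitaryGroup n ℂ) :
    ‖U‖ ≤ 1 := by
  cases subsingleton_or_nontrivial (Matrix n n ℂ)
  · simp [Subsingleton.elim U 0]
  · exact (CStarRing.norm_of_mem_unitary hU).le

lemma norm_propagator_le_one {A : Matrix n n ℂ} (hA : A.IsHermitian) (t : ℝ) :
    ‖propagator A t‖ ≤ 1 :=
  norm_le_one_of_mem_unitaryGroup (propagator_mem_unitaryGroup hA t)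

lemma norm_propagator_mul_I_smul_mul_le {H : Matrix n n ℂ} (hH : H.IsHermitian) (t : ℝ)
    (V B : Matrix n n ℂ) : ‖propagator H t * (Complex.I • V) * B‖ ≤ ‖V‖ * ‖B‖ :=
  calc ‖propagator H t * (Complex.I • V) * B‖
      ≤ ‖propagator H t‖ * ‖Complex.I • V‖ * ‖B‖ := norm_mul₃_le
    _ ≤ 1 * ‖Complex.I • V‖ * ‖B‖ := by gcongr; exact norm_propagator_le_one hH t
    _ = ‖V‖ * ‖B‖ := by rw [one_mul, norm_smul, Complex.norm_I, one_mul]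

lemma norm_interactionPicture_sub_one_le {H V : Matrix n n ℂ} (hH : H.IsHermitian)
    (hV : V.IsHermitian) {t : ℝ} (ht : 0 ≤ t) : ‖interactionPicture H V t - 1‖ ≤ ‖V‖ * t := by
  have bound := norm_image_sub_le_of_norm_deriv_le_segment' (C := ‖V‖)
    (fun s _ => (hasDerivAt_interactionPicture H V s).hasDerivWithinAt)
    (fun s _ => (norm_propagator_mul_I_smul_mul_le hH.neg s V _).trans <|
      mul_le_of_le_one_right (norm_nonneg _) (norm_propagator_le_one (hH.add hV) s))
    t (Set.right_mem_Icc.2 ht)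
  rwa [interactionPicture_zero, sub_zero] at bound

lemma norm_propagator_add_sub_le {H V : Matrix n n ℂ} (hH : H.IsHermitian) (hV : V.IsHermitian)
    {t : ℝ} (ht : 0 ≤ t) : ‖propagator (H + V) t - propagator H t‖ ≤ ‖V‖ * t := by
  have cancel : propagator H t * propagator (-H) t = 1 := by
    simpa using propagator_neg_mul_self (-H) t
  calc ‖propagator (H + V) t - propagator H t‖
      = ‖propagator H t * (interactionPicture H V t - 1)‖ := by
        rw [mul_sub, mul_one, interactionPicture, ← mul_assoc, cancel, one_mul]
    _ ≤ ‖propagator H t‖ * ‖interactionPicture H V t - 1‖ := norm_mul_le _ _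
    _ ≤ 1 * (‖V‖ * t) := by
        gcongr
        exacts [norm_propagator_le_one hH t, norm_interactionPicture_sub_one_le hH hV ht]
    _ = ‖V‖ * t := one_mul _

lemma norm_entry_le_l2_opNorm (A : Matrix n n ℂ) (i j : n) : ‖A i j‖ ≤ ‖A‖ := by
  have bound := Matrix.l2_opNorm_mulVec A (EuclideanSpace.single j (1 : ℂ))
  rw [PiLp.norm_single, norm_one, mul_one] at bound
  refine le_trans ?_ bound
  simpa using PiLp.norm_apply_le (WithLp.toLp 2 (A *ᵥ Pi.single j (1 : ℂ))) i

/-- The phase integral `∫₀ᵗ e^{-iωx} dx` of first order perturbation theory. -/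
def phaseIntegral (ω t : ℝ) : ℂ := ∫ x in (0 : ℝ)..t, Complex.exp (-Complex.I * ω * x)

lemma hasDerivAt_phaseIntegral (ω t : ℝ) :
    HasDerivAt (phaseIntegral ω) (Complex.exp (-Complex.I * ω * t)) t := by
  have hc : Continuous fun x : ℝ => Complex.exp (-Complex.I * ω * x) := by fun_prop
  exact intervalIntegral.integral_hasDerivAt_right (hc.intervalIntegrable _ _)
    (hc.stronglyMeasurableAtFilter _ _) hc.continuousAt

lemma norm_phaseIntegral (ω t : ℝ) : ‖phaseIntegral ω t‖ = |t| * |Real.sinc (ω * t / 2)| := by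
  rcases eq_or_ne t 0 with rfl | ht
  · simp [phaseIntegral]
  rcases eq_or_ne ω 0 with rfl | hω
  · simp [phaseIntegral]
  have chord : ‖Complex.exp (-Complex.I * ω * t) - 1‖ = 2 * |Real.sin (ω * t / 2)| := by
    have := Complex.norm_exp_I_mul_ofReal_sub_one (-(ω * t))
    rw [neg_div, Real.sin_neg, mul_neg, norm_neg, Real.norm_eq_abs, abs_mul, abs_two] at this
    rw [← this]
    push_cast
    ring_nf
  rw [phaseIntegral, integral_exp_mul_complex (by simp [hω]), Complex.ofReal_zero, mul_zero,
    Complex.exp_zero, norm_div, chord, Real.sinc_of_ne_zero (by positivity)]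
  simp only [neg_mul, norm_neg, Complex.norm_mul, Complex.norm_I, Complex.norm_real,
    Real.norm_eq_abs, one_mul, abs_div, abs_mul, abs_two]
  field_simp

lemma first_order_phase (E : n → ℝ) (V : Matrix n n ℂ) (a b : n) (t : ℝ) :
    (propagator (-realDiagonal E) t * (Complex.I • V) * propagator (realDiagonal E) t) a b
      = Complex.I * V a b * Complex.exp (-Complex.I * (E a - E b : ℝ) * t) := by
  rw [← realDiagonal_neg, propagator_realDiagonal, propagator_realDiagonal, Matrix.mul_diagonal,
    Matrix.diagonal_mul, Matrix.smul_apply, smul_eq_mul,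
    show -Complex.I * ((E a - E b : ℝ) : ℂ) * t
      = Complex.I * t * ((-E) a : ℝ) + Complex.I * t * E b by push_cast [Pi.neg_apply]; ring,
    Complex.exp_add]
  ring

/-- The remainder has derivative `e^{-iHs} iV (e^{i(H+V)s} - e^{iHs})`, of norm at most
`‖V‖ · ‖V‖ s`. -/
lemma norm_interactionPicture_sub_first_order_le (E : n → ℝ) {V : Matrix n n ℂ}
    (hV : V.IsHermitian) {t : ℝ} (ht : 0 ≤ t) (a b : n) :
    ‖(interactionPicture (realDiagonal E) V t - 1) a b
        - Complex.I * V a b * phaseIntegral (E a - E b) t‖ ≤ (‖V‖ * t) ^ 2 := by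
  set H := realDiagonal E
  have hH : H.IsHermitian := isHermitian_realDiagonal E
  set R : ℝ → ℂ := fun s =>
    interactionPicture H V s a b - Complex.I * V a b * phaseIntegral (E a - E b) s with hR
  have derivR : ∀ s, HasDerivAt R
      ((propagator (-H) s * (Complex.I • V) * (propagator (H + V) s - propagator H s)) a b) s := by
    intro s
    rw [mul_sub, Matrix.sub_apply, first_order_phase]
    exact (hasDerivAt_pi.1 (hasDerivAt_pi.1 (hasDerivAt_interactionPicture H V s) a) b).sub
      ((hasDerivAt_phaseIntegral (E a - E b) s).const_mul _)
  have derivR_le : ∀ s ∈ Set.Ico 0 t,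
      ‖(propagator (-H) s * (Complex.I • V) * (propagator (H + V) s - propagator H s)) a b‖
        ≤ ‖V‖ ^ 2 * t := fun s hs => by
    refine (norm_entry_le_l2_opNorm _ _ _).trans
      ((norm_propagator_mul_I_smul_mul_le hH.neg s V _).trans ?_)
    rw [sq, mul_assoc]
    gcongr
    exact (norm_propagator_add_sub_le hH hV hs.1).trans (by gcongr; exact hs.2.le)
  have bound := norm_image_sub_le_of_norm_deriv_le_segment'
    (fun s _ => (derivR s).hasDerivWithinAt) derivR_le t (Set.right_mem_Icc.2 ht)
  calc _ = ‖R t - R 0‖ := by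
        simp only [hR, interactionPicture_zero, Matrix.sub_apply, phaseIntegral,
          intervalIntegral.integral_same]
        ring_nf
    _ ≤ ‖V‖ ^ 2 * t * (t - 0) := bound
    _ = (‖V‖ * t) ^ 2 := by ring

lemma norm_interactionPicture_apply (E : n → ℝ) (V : Matrix n n ℂ) (t : ℝ) (a b : n) :
    ‖interactionPicture (realDiagonal E) V t a b‖ = ‖propagator (realDiagonal E + V) t a b‖ := by
  rw [interactionPicture, ← realDiagonal_neg, propagator_realDiagonal, Matrix.diagonal_mul,
    norm_mul, Complex.norm_exp]
  simp

end Propagator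

/-! ### Moments of Haar random unitaries and of the random interaction -/

section Haar

variable {n : Type*} [Fintype n] [DecidableEq n] {E : Type*} [NormedAddCommGroup E]

instance isProbabilityMeasure_haarUnitary : IsProbabilityMeasure (haarUnitary n) :=
  ⟨Measure.haarMeasure_self⟩

instance isMulLeftInvariant_haarUnitary : (haarUnitary n).IsMulLeftInvariant :=
  inferInstanceAs (Measure.haarMeasure _).IsMulLeftInvariant

instance secondCountableTopology_unitaryGroup :
    SecondCountableTopology (Matrix.unitaryGroup n ℂ) :=
  haveI : SecondCountableTopology (Matrix n n ℂ) :=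
    inferInstanceAs (SecondCountableTopology (n → n → ℂ))
  TopologicalSpace.Subtype.secondCountableTopology _

lemma integrable_haarUnitary {f : Matrix.unitaryGroup n ℂ → E} (hf : Continuous f) :
    Integrable f (haarUnitary n) :=
  haveI : IsFiniteMeasureOnCompacts (haarUnitary n) := inferInstance
  hf.integrable_of_hasCompactSupport (HasCompactSupport.of_compactSpace f)

@[fun_prop]
lemma continuous_unitaryGroup_apply (a b : n) :
    Continuous fun U : Matrix.unitaryGroup n ℂ => (U : Matrix n n ℂ) a b :=
  continuous_subtype_val.matrix_elem a b

lemma sum_normSq_row {U : Matrix n n ℂ} (hU : U ∈ Matrix.unitaryGroup n ℂ) (a : n) :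
    ∑ k, ‖U a k‖ ^ 2 = 1 := by
  have hdiag := congrFun₂ (Matrix.mem_unitaryGroup_iff.1 hU) a a
  simp only [Matrix.mul_apply, Matrix.star_apply, RCLike.star_def, Complex.mul_conj',
    Matrix.one_apply_eq] at hdiag
  exact_mod_cast hdiag

lemma sum_normSq_col {U : Matrix n n ℂ} (hU : U ∈ Matrix.unitaryGroup n ℂ) (k : n) :
    ∑ a, ‖U a k‖ ^ 2 = 1 := by
  simpa [Matrix.star_apply] using sum_normSq_row (Unitary.star_mem hU) k

lemma swap_mem_unitaryGroup (a b : n) : Matrix.swap ℂ a b ∈ Matrix.unitaryGroup n ℂ := by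
  rw [Matrix.mem_unitaryGroup_iff, Matrix.star_eq_conjTranspose, Matrix.conjTranspose_swap,
    Matrix.swap_mul_self]

/-- The rotation `(1 + iS)/√2`, with `S` the transposition of `a` and `b`. -/
def halfSwap (a b : n) : Matrix n n ℂ := ((√2)⁻¹ : ℂ) • (1 + Complex.I • Matrix.swap ℂ a b)

lemma inv_sqrt_two_mul_self : ((√2)⁻¹ : ℂ) * ((√2)⁻¹ : ℂ) = 2⁻¹ := by
  rw [← mul_inv, ← Complex.ofReal_mul, Real.mul_self_sqrt zero_le_two, Complex.ofReal_ofNat]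

lemma halfSwap_mem_unitaryGroup (a b : n) : halfSwap a b ∈ Matrix.unitaryGroup n ℂ := by
  have hprod : (1 + Complex.I • Matrix.swap ℂ a b) * (1 - Complex.I • Matrix.swap ℂ a b)
      = (2 : ℂ) • 1 := by
    simp only [add_mul, mul_sub, one_mul, mul_one, smul_mul_smul_comm, Matrix.swap_mul_self,
      Complex.I_mul_I, neg_smul, one_smul, two_smul]
    abel
  have hstar : star (1 + Complex.I • Matrix.swap ℂ a b) = 1 - Complex.I • Matrix.swap ℂ a b := by
    rw [star_add, star_one, star_smul, Matrix.star_eq_conjTranspose, Matrix.conjTranspose_swap,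
      RCLike.star_def, Complex.conj_I, neg_smul, sub_eq_add_neg]
  rw [Matrix.mem_unitaryGroup_iff, halfSwap, star_smul, hstar, smul_mul_smul_comm, hprod, smul_smul,
    RCLike.star_def, map_inv₀, Complex.conj_ofReal, inv_sqrt_two_mul_self]
  norm_num

lemma halfSwap_mul_apply_left (a b : n) (M : Matrix n n ℂ) (k : n) :
    (halfSwap a b * M) a k = ((√2)⁻¹ : ℂ) * (M a k + Complex.I * M b k) := by
  simp [halfSwap, add_mul, mul_add]

lemma sum_norm_add_fourth_root_mul_pow_four (u v : ℂ) :
    ‖u + 1 * v‖ ^ 4 + ‖u + -1 * v‖ ^ 4 + ‖u + Complex.I * v‖ ^ 4 + ‖u + -Complex.I * v‖ ^ 4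
      = 4 * (‖u‖ ^ 4 + ‖v‖ ^ 4 + 4 * (‖u‖ ^ 2 * ‖v‖ ^ 2)) := by
  have hsq : ∀ z : ℂ, ‖z‖ ^ 2 = z.re ^ 2 + z.im ^ 2 := fun z => by
    rw [Complex.sq_norm, Complex.normSq_apply]; ring
  simp only [show (4 : ℕ) = 2 * 2 from rfl, pow_mul, hsq, Complex.add_re, Complex.add_im,
    Complex.mul_re, Complex.mul_im, Complex.neg_re, Complex.neg_im, Complex.one_re, Complex.one_im,
    Complex.I_re, Complex.I_im]
  ring

variable [NormedSpace ℝ E]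

lemma integral_haarUnitary_mul_left {W : Matrix n n ℂ} (hW : W ∈ Matrix.unitaryGroup n ℂ)
    (f : Matrix n n ℂ → E) :
    ∫ U, f (W * (U : Matrix n n ℂ)) ∂haarUnitary n = ∫ U, f (U : Matrix n n ℂ) ∂haarUnitary n :=
  integral_mul_left_eq_self (μ := haarUnitary n) (fun U => f (U : Matrix n n ℂ))
    (⟨W, hW⟩ : Matrix.unitaryGroup n ℂ)

lemma integral_haarUnitary_row_eq (f : ℂ → E) (a b k : n) :
    ∫ U, f ((U : Matrix n n ℂ) a k) ∂haarUnitary n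
      = ∫ U, f ((U : Matrix n n ℂ) b k) ∂haarUnitary n := by
  simpa using integral_haarUnitary_mul_left (swap_mem_unitaryGroup a b) fun M => f (M b k)

lemma integral_haarUnitary_rotate {a b : n} (hab : a ≠ b) (k : n) {ζ : ℂ} (hζ : ‖ζ‖ = 1)
    (f : ℂ → E) :
    ∫ U, f (((√2)⁻¹ : ℂ) * ((U : Matrix n n ℂ) a k + ζ * (U : Matrix n n ℂ) b k)) ∂haarUnitary n
      = ∫ U, f ((U : Matrix n n ℂ) a k) ∂haarUnitary n := by
  set phase : n → ℂ := fun i => if i = b then -Complex.I * ζ else 1 with hphase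
  have hmem : halfSwap a b * Matrix.diagonal phase ∈ Matrix.unitaryGroup n ℂ :=
    mul_mem (halfSwap_mem_unitaryGroup a b) <| diagonal_mem_unitaryGroup fun i => by
      simp only [hphase]; split_ifs <;> simp [hζ]
  rw [← integral_haarUnitary_mul_left hmem fun M => f (M a k)]
  congr 1 with U
  rw [mul_assoc, halfSwap_mul_apply_left, Matrix.diagonal_mul, Matrix.diagonal_mul]
  simp only [hphase, if_true, if_neg hab, one_mul, ← mul_assoc, mul_neg, Complex.I_mul_I, neg_neg]

lemma integral_haarUnitary_normSq (a k : n) :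
    ∫ U, ‖(U : Matrix n n ℂ) a k‖ ^ 2 ∂haarUnitary n = 1 / Fintype.card n := by
  have : Nonempty n := ⟨a⟩
  have total : ∑ b, ∫ U, ‖(U : Matrix n n ℂ) b k‖ ^ 2 ∂haarUnitary n = 1 := by
    rw [← integral_finsetSum _ fun b _ => integrable_haarUnitary (by fun_prop)]
    simp [fun U : Matrix.unitaryGroup n ℂ => sum_normSq_col U.2 k]
  rw [Finset.sum_congr rfl fun b _ => integral_haarUnitary_row_eq (fun z => ‖z‖ ^ 2) b a k,
    Finset.sum_const, Finset.card_univ, nsmul_eq_mul] at total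
  rwa [eq_div_iff (by exact_mod_cast Fintype.card_ne_zero), mul_comm]

/-- Averaging `|(U_{ak} + ζ U_{bk}) / √2|⁴` over the fourth roots of unity `ζ` isolates the mixed
moment, while each of the four terms has the law of `|U_{ak}|⁴`. -/
lemma two_mul_integral_haarUnitary_normSq_mul_normSq {a b : n} (hab : a ≠ b) (k : n) :
    2 * ∫ U, ‖(U : Matrix n n ℂ) a k‖ ^ 2 * ‖(U : Matrix n n ℂ) b k‖ ^ 2 ∂haarUnitary n
      = ∫ U, ‖(U : Matrix n n ℂ) a k‖ ^ 4 ∂haarUnitary n := by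
  have scale : ‖((√2)⁻¹ : ℂ)‖ ^ 4 = 1 / 4 := by
    rw [show (4 : ℕ) = 2 * 2 from rfl, pow_mul, ← norm_pow, sq (_⁻¹), inv_sqrt_two_mul_self]
    norm_num
  have rotated : ∀ ζ : ℂ, ‖ζ‖ = 1 →
      ∫ U, ‖(U : Matrix n n ℂ) a k + ζ * (U : Matrix n n ℂ) b k‖ ^ 4 ∂haarUnitary n
        = 4 * ∫ U, ‖(U : Matrix n n ℂ) a k‖ ^ 4 ∂haarUnitary n := fun ζ hζ => by
    rw [← integral_haarUnitary_rotate hab k hζ fun z => ‖z‖ ^ 4]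
    simp only [norm_mul _ (_ + _), mul_pow, scale, integral_const_mul]
    ring
  have average := integral_congr_ae (μ := haarUnitary n) <| Eventually.of_forall fun U =>
    sum_norm_add_fourth_root_mul_pow_four ((U : Matrix n n ℂ) a k) ((U : Matrix n n ℂ) b k)
  rw [integral_add, integral_add, integral_add, rotated 1 (by simp), rotated (-1) (by simp),
    rotated _ Complex.norm_I, rotated (-Complex.I) (by simp), integral_const_mul, integral_add,
    integral_add, integral_haarUnitary_row_eq (fun z => ‖z‖ ^ 4) b a k, integral_const_mul]
    at average
  · linarith
  all_goals exact integrable_haarUnitary (by fun_prop)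

lemma integral_haarUnitary_normSq_mul_normSq {a b : n} (hab : a ≠ b) (k : n) :
    ∫ U, ‖(U : Matrix n n ℂ) a k‖ ^ 2 * ‖(U : Matrix n n ℂ) b k‖ ^ 2 ∂haarUnitary n
      = 1 / (Fintype.card n * (Fintype.card n + 1)) := by
  set y := ∫ U, ‖(U : Matrix n n ℂ) a k‖ ^ 4 ∂haarUnitary n
  have moment : ∀ c,
      ∫ U, ‖(U : Matrix n n ℂ) a k‖ ^ 2 * ‖(U : Matrix n n ℂ) c k‖ ^ 2 ∂haarUnitary n
        = y / 2 + if c = a then y / 2 else 0 := fun c => by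
    split_ifs with hca
    · subst hca
      simp only [← pow_add, add_halves, y]
    · linarith [two_mul_integral_haarUnitary_normSq_mul_normSq (Ne.symm hca) k]
  have total : ∑ c,
      ∫ U, ‖(U : Matrix n n ℂ) a k‖ ^ 2 * ‖(U : Matrix n n ℂ) c k‖ ^ 2 ∂haarUnitary n
        = 1 / Fintype.card n := by
    rw [← integral_finsetSum _ fun c _ => integrable_haarUnitary (by fun_prop),
      ← integral_haarUnitary_normSq a k]
    simp only [← Finset.mul_sum, fun U : Matrix.unitaryGroup n ℂ => sum_normSq_col U.2 k, mul_one]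
  simp only [moment, Finset.sum_add_distrib, Finset.sum_const, Finset.card_univ, nsmul_eq_mul,
    Finset.sum_ite_eq', Finset.mem_univ, if_true] at total
  have hn : (0 : ℝ) < Fintype.card n := by exact_mod_cast Fintype.card_pos_iff.2 ⟨a⟩
  rw [moment b, if_neg hab.symm, add_zero, eq_div_iff (by positivity)]
  field_simp at total ⊢
  linarith

end Haar

section Interaction

lemma normSq_sum_mul_ofReal {ι : Type*} [Fintype ι] (c : ι → ℂ) (x : ι → ℝ) :
    ‖∑ k, c k * x k‖ ^ 2 = ∑ k, ∑ l, (c k * star (c l)).re * (x k * x l) := by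
  have expand : (∑ k, c k * (x k : ℂ)) * star (∑ k, c k * (x k : ℂ))
      = ∑ k, ∑ l, c k * star (c l) * ((x k * x l : ℝ) : ℂ) := by
    rw [star_sum, Finset.sum_mul_sum]
    refine Finset.sum_congr rfl fun k _ => Finset.sum_congr rfl fun l _ => ?_
    rw [star_mul', RCLike.star_def, Complex.conj_ofReal]
    push_cast
    ring
  have hre := congrArg Complex.re expand
  rw [RCLike.star_def, Complex.mul_conj', ← Complex.ofReal_pow, Complex.ofReal_re] at hre
  simpa only [Complex.re_sum, Complex.re_mul_ofReal, RCLike.star_def] using hre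

lemma integral_normSq_sum_of_orthonormal {Ω ι : Type*} [MeasurableSpace Ω] {μ : Measure Ω}
    [Fintype ι] [DecidableEq ι] {X : ι → Ω → ℝ} (hX : ∀ k, MemLp (X k) 2 μ)
    (horth : ∀ k l, ∫ ω, X k ω * X l ω ∂μ = if k = l then 1 else 0) (c : ι → ℂ) :
    ∫ ω, ‖∑ k, c k * (X k ω : ℂ)‖ ^ 2 ∂μ = ∑ k, ‖c k‖ ^ 2 := by
  have hint : ∀ k l, Integrable (fun ω => (c k * star (c l)).re * (X k ω * X l ω)) μ :=
    fun k l => ((hX k).integrable_mul (hX l)).const_mul _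
  simp only [normSq_sum_mul_ofReal]
  rw [integral_finsetSum _ fun k _ => integrable_finsetSum _ fun l _ => hint k l]
  refine Finset.sum_congr rfl fun k _ => ?_
  rw [integral_finsetSum _ fun l _ => hint k l]
  simp only [integral_const_mul, horth, mul_ite, mul_one, mul_zero, Finset.sum_ite_eq,
    Finset.mem_univ, if_true]
  rw [RCLike.star_def, Complex.mul_conj', ← Complex.ofReal_pow, Complex.ofReal_re]

variable {n : Type*} [Fintype n]

/-- The law of i.i.d. standard normal eigenvalues, the second factor of `interactionLaw`. -/
abbrev normalLaw (n : Type*) [Fintype n] : Measure (n → ℝ) := Measure.pi fun _ => gaussianReal 0 1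

lemma memLp_normalLaw_eval (k : n) (q : NNReal) :
    MemLp (fun d : n → ℝ => d k) q (normalLaw n) :=
  (memLp_id_gaussianReal q).comp_measurePreserving
    (measurePreserving_eval (fun _ : n => gaussianReal 0 1) k)

lemma integral_normalLaw_eval (k : n) : ∫ d, d k ∂normalLaw n = 0 := by
  rw [integral_comp_eval (μ := fun _ : n => gaussianReal 0 1) (f := fun x : ℝ => x) (by fun_prop)]
  exact integral_id_gaussianReal

lemma integral_normalLaw_sq (k : n) : ∫ d, d k * d k ∂normalLaw n = 1 := by
  rw [integral_comp_eval (μ := fun _ : n => gaussianReal 0 1) (f := fun x : ℝ => x * x)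
    (by fun_prop)]
  have hvar := variance_id_gaussianReal (μ := 0) (v := 1)
  rw [variance_of_integral_eq_zero aemeasurable_id integral_id_gaussianReal] at hvar
  simpa [pow_two] using hvar

lemma integrable_normalLaw_sum_sq_sq :
    Integrable (fun d : n → ℝ => (∑ i, d i ^ 2) ^ 2) (normalLaw n) := by
  refine MemLp.integrable_sq (memLp_finsetSum _ fun i _ => ?_)
  rw [memLp_two_iff_integrable_sq ((measurable_pi_apply i).pow_const 2).aestronglyMeasurable]
  refine ((memLp_normalLaw_eval i 4).integrable_norm_pow (p := 4) (by norm_num)).congr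
    (Eventually.of_forall fun d => ?_)
  simp only [Real.norm_eq_abs]
  rw [← pow_mul, Even.pow_abs (by decide)]

lemma memLp_two_normalLaw_eval (k : n) : MemLp (fun d : n → ℝ => d k) 2 (normalLaw n) := by
  simpa using memLp_normalLaw_eval k 2

variable [DecidableEq n]

lemma integral_normalLaw_mul (k l : n) :
    ∫ d, d k * d l ∂normalLaw n = if k = l then 1 else 0 := by
  split_ifs with hkl
  · rw [hkl, integral_normalLaw_sq]
  · have hind := (iIndepFun_pi (μ := fun _ : n => gaussianReal 0 1) (X := fun _ x => x)
      fun _ => aemeasurable_id).indepFun hkl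
    refine (hind.integral_mul_eq_mul_integral (memLp_normalLaw_eval k 1).1
      (memLp_normalLaw_eval l 1).1).trans ?_
    rw [integral_normalLaw_eval, zero_mul]

instance isProbabilityMeasure_interactionLaw : IsProbabilityMeasure (interactionLaw n) :=
  inferInstanceAs (IsProbabilityMeasure (Measure.prod _ _))

lemma isHermitian_interaction (p : Matrix.unitaryGroup n ℂ × (n → ℝ)) :
    (interaction p).IsHermitian :=
  Matrix.isHermitian_mul_mul_conjTranspose _ (isHermitian_realDiagonal p.2)

lemma continuous_interaction : Continuous (interaction (n := n)) := by
  have hU : Continuous fun p : Matrix.unitaryGroup n ℂ × (n → ℝ) => (p.1 : Matrix n n ℂ) :=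
    continuous_subtype_val.comp continuous_fst
  have hD : Continuous fun p : Matrix.unitaryGroup n ℂ × (n → ℝ) =>
      Matrix.diagonal fun i => (p.2 i : ℂ) := Continuous.matrix_diagonal (by fun_prop)
  exact (hU.mul hD).mul hU.matrix_conjTranspose

lemma interaction_apply (p : Matrix.unitaryGroup n ℂ × (n → ℝ)) (a b : n) :
    interaction p a b
      = ∑ k, ((p.1 : Matrix n n ℂ) a k * star ((p.1 : Matrix n n ℂ) b k)) * p.2 k := by
  rw [interaction, Matrix.mul_apply]
  refine Finset.sum_congr rfl fun k _ => ?_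
  rw [Matrix.mul_diagonal, Matrix.conjTranspose_apply]
  ring

open scoped Matrix.Norms.L2Operator

lemma norm_realDiagonal_sq_le (x : n → ℝ) : ‖realDiagonal x‖ ^ 2 ≤ ∑ i, x i ^ 2 := by
  refine (Real.le_sqrt (norm_nonneg _) (by positivity)).1 ?_
  rw [realDiagonal, Matrix.l2_opNorm_diagonal, pi_norm_le_iff_of_nonneg (Real.sqrt_nonneg _)]
  intro i
  rw [Complex.norm_real]
  exact Real.abs_le_sqrt (Finset.single_le_sum (fun j _ => sq_nonneg (x j)) (Finset.mem_univ i))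

lemma norm_interaction_sq_le (p : Matrix.unitaryGroup n ℂ × (n → ℝ)) :
    ‖interaction p‖ ^ 2 ≤ ∑ i, p.2 i ^ 2 := by
  have hU := norm_le_one_of_mem_unitaryGroup p.1.2
  have hle : ‖interaction p‖ ≤ ‖realDiagonal p.2‖ :=
    calc ‖interaction p‖ ≤ ‖(p.1 : Matrix n n ℂ)‖ * ‖realDiagonal p.2‖ * ‖(p.1 : Matrix n n ℂ)ᴴ‖ :=
          norm_mul₃_le
      _ ≤ 1 * ‖realDiagonal p.2‖ * 1 := by rw [Matrix.l2_opNorm_conjTranspose]; gcongr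
      _ = ‖realDiagonal p.2‖ := by ring
  exact (pow_le_pow_left₀ (norm_nonneg _) hle 2).trans (norm_realDiagonal_sq_le p.2)

lemma integrable_norm_interaction_pow_four :
    Integrable (fun p => ‖interaction p‖ ^ 4) (interactionLaw n) := by
  have hdom : Integrable (fun p : Matrix.unitaryGroup n ℂ × (n → ℝ) => (∑ i, p.2 i ^ 2) ^ 2)
      (interactionLaw n) := integrable_normalLaw_sum_sq_sq.comp_snd _
  refine hdom.mono' (continuous_interaction.norm.pow 4).aestronglyMeasurable
    (Eventually.of_forall fun p => ?_)
  rw [Real.norm_of_nonneg (by positivity), show (4 : ℕ) = 2 * 2 from rfl, pow_mul]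
  gcongr
  exact norm_interaction_sq_le p

lemma integrable_normSq_interaction_apply (a b : n) :
    Integrable (fun p => ‖interaction p a b‖ ^ 2) (interactionLaw n) := by
  refine ((integrable_const 1).add integrable_norm_interaction_pow_four).mono'
    ((continuous_interaction.matrix_elem a b).norm.pow 2).aestronglyMeasurable
    (Eventually.of_forall fun p => ?_)
  have hle : ‖interaction p a b‖ ^ 2 ≤ ‖interaction p‖ ^ 2 := by
    gcongr
    exact norm_entry_le_l2_opNorm _ _ _
  rw [Real.norm_of_nonneg (by positivity), Pi.add_apply]
  nlinarith [sq_nonneg (‖interaction p‖ ^ 2 - 1)]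

lemma integral_normSq_interaction_apply {a b : n} (hab : a ≠ b) :
    ∫ p, ‖interaction p a b‖ ^ 2 ∂interactionLaw n = 1 / (Fintype.card n + 1) := by
  have hn : (0 : ℝ) < Fintype.card n := by exact_mod_cast Fintype.card_pos_iff.2 ⟨a⟩
  have condExp (c : n → ℂ) := integral_normSq_sum_of_orthonormal
    (μ := normalLaw n) memLp_two_normalLaw_eval integral_normalLaw_mul c
  rw [interactionLaw, integral_prod _ (integrable_normSq_interaction_apply a b)]
  simp only [interaction_apply, condExp, norm_mul, norm_star, mul_pow]
  rw [integral_finsetSum _ fun k _ => integrable_haarUnitary (by fun_prop)]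
  simp only [integral_haarUnitary_normSq_mul_normSq hab, Finset.sum_const, Finset.card_univ,
    nsmul_eq_mul]
  field_simp

end Interaction

/-! ### The averaged evolution -/

section UnitaryConjugation

variable {n : Type*} [Fintype n] [DecidableEq n]

lemma unitary_conj_mul_conj {W : Matrix n n ℂ} (hW : W ∈ Matrix.unitaryGroup n ℂ)
    (A B : Matrix n n ℂ) : (W * A * Wᴴ) * (W * B * Wᴴ) = W * (A * B) * Wᴴ := by
  have cancel : Wᴴ * W = 1 := Matrix.mem_unitaryGroup_iff'.1 hW
  calc (W * A * Wᴴ) * (W * B * Wᴴ) = W * A * (Wᴴ * W) * B * Wᴴ := by simp only [mul_assoc]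
    _ = W * (A * B) * Wᴴ := by rw [cancel, mul_one, mul_assoc W]

lemma exp_unitary_conj {W : Matrix n n ℂ} (hW : W ∈ Matrix.unitaryGroup n ℂ) (A : Matrix n n ℂ) :
    NormedSpace.exp (W * A * Wᴴ) = W * NormedSpace.exp A * Wᴴ := by
  have hWW : W * Wᴴ = 1 := Matrix.mem_unitaryGroup_iff.1 hW
  rw [← Matrix.inv_eq_right_inv hWW, Matrix.exp_conj _ _ (IsUnit.of_mul_eq_one _ hWW)]

lemma evolve_conj (H G : Matrix n n ℂ) (α t : ℝ) {W : Matrix n n ℂ}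
    (hW : W ∈ Matrix.unitaryGroup n ℂ) (X : Matrix n n ℂ) :
    evolve (W * H * Wᴴ) (W * G * Wᴴ) α t (W * X * Wᴴ) = W * evolve H G α t X * Wᴴ := by
  have exp_conj : ∀ z : ℂ, NormedSpace.exp (z • (W * H * Wᴴ + (α : ℂ) • (W * G * Wᴴ)))
      = W * NormedSpace.exp (z • (H + (α : ℂ) • G)) * Wᴴ := fun z => by
    rw [← exp_unitary_conj hW]
    simp only [mul_add, add_mul, smul_add, mul_smul_comm, smul_mul_assoc]
  rw [evolve, exp_conj, exp_conj, unitary_conj_mul_conj hW, unitary_conj_mul_conj hW, evolve]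

end UnitaryConjugation

section MatrixIntegral

variable {n : Type*} [Fintype n]

lemma integral_mul_mul_apply {Ω : Type*} [MeasurableSpace Ω] {μ : Measure Ω}
    {F : Ω → Matrix n n ℂ} (hF : ∀ c d, Integrable (fun ω => F ω c d) μ) (A B : Matrix n n ℂ)
    (a b : n) :
    ∫ ω, (A * F ω * B) a b ∂μ = (A * Matrix.of (fun c d => ∫ ω, F ω c d ∂μ) * B) a b := by
  have hint : ∀ c d, Integrable (fun ω => A a c * F ω c d * B d b) μ := fun c d =>
    ((hF c d).const_mul _).mul_const _
  simp only [Matrix.mul_apply, Finset.sum_mul, Matrix.of_apply]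
  rw [integral_finsetSum _ fun d _ => integrable_finsetSum _ fun c _ => hint c d]
  refine Finset.sum_congr rfl fun d _ => ?_
  rw [integral_finsetSum _ fun c _ => hint c d]
  simp only [integral_mul_const, integral_const_mul]

end MatrixIntegral

section Average

open scoped Matrix.Norms.L2Operator

variable {n : Type*} [Fintype n] [DecidableEq n]

/-- The evolution averaged over the random interaction. -/
def averageEvolve (H : Matrix n n ℂ) (α t : ℝ) (X : Matrix n n ℂ) : Matrix n n ℂ :=
  Matrix.of fun a b => ∫ p, evolve H (interaction p) α t X a b ∂interactionLaw n

/-- The averaged transition probabilities between the levels of the Hamiltonian with spectrum `E`;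
the row index is the final level. -/
def transitionMatrix (E : n → ℝ) (α t : ℝ) : Matrix n n ℝ :=
  Matrix.of fun a b =>
    ∫ p, ‖propagator (realDiagonal E + (α : ℂ) • interaction p) t a b‖ ^ 2 ∂interactionLaw n

lemma isHermitian_smul_interaction (α : ℝ) (p : Matrix.unitaryGroup n ℂ × (n → ℝ)) :
    ((α : ℂ) • interaction p).IsHermitian := by
  rw [Matrix.IsHermitian, Matrix.conjTranspose_smul, (isHermitian_interaction p).eq]
  simp

lemma isHermitian_add_smul_interaction {H : Matrix n n ℂ} (hH : H.IsHermitian) (α : ℝ)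
    (p : Matrix.unitaryGroup n ℂ × (n → ℝ)) : (H + (α : ℂ) • interaction p).IsHermitian :=
  hH.add (isHermitian_smul_interaction α p)

lemma continuous_propagator_interaction (H : Matrix n n ℂ) (α t : ℝ) :
    Continuous fun p => propagator (H + (α : ℂ) • interaction p) t := by
  have hc : Continuous fun p => (Complex.I * (t : ℂ)) • (H + (α : ℂ) • interaction (n := n) p) :=
    (continuous_const.add (continuous_interaction.fun_const_smul _)).fun_const_smul _
  let _ : NormedAlgebra ℚ (Matrix n n ℂ) := NormedAlgebra.restrictScalars ℚ ℂ _
  exact NormedSpace.exp_continuous.comp hc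

lemma evolve_eq_propagator {H : Matrix n n ℂ} (hH : H.IsHermitian) (α t : ℝ)
    (p : Matrix.unitaryGroup n ℂ × (n → ℝ)) (X : Matrix n n ℂ) :
    evolve H (interaction p) α t X = propagator (H + (α : ℂ) • interaction p) t * X *
      (propagator (H + (α : ℂ) • interaction p) t)ᴴ := by
  rw [conjTranspose_propagator (isHermitian_add_smul_interaction hH α p), propagator, propagator,
    smul_neg, ← neg_smul, evolve]

lemma norm_evolve_interaction_le {H : Matrix n n ℂ} (hH : H.IsHermitian) (α t : ℝ)
    (p : Matrix.unitaryGroup n ℂ × (n → ℝ)) (X : Matrix n n ℂ) :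
    ‖evolve H (interaction p) α t X‖ ≤ ‖X‖ := by
  have hprop := norm_propagator_le_one (isHermitian_add_smul_interaction hH α p) t
  rw [evolve_eq_propagator hH]
  refine norm_mul₃_le.trans ?_
  rw [Matrix.l2_opNorm_conjTranspose]
  exact (mul_le_of_le_one_right (by positivity) hprop).trans
    (mul_le_of_le_one_left (norm_nonneg X) hprop)

lemma integrable_evolve {H : Matrix n n ℂ} (hH : H.IsHermitian) (α t : ℝ) (X : Matrix n n ℂ)
    (a b : n) :
    Integrable (fun p => evolve H (interaction p) α t X a b) (interactionLaw n) := by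
  have hprop := continuous_propagator_interaction H α t
  have hc : Continuous fun p => evolve H (interaction p) α t X := by
    simp only [evolve_eq_propagator hH]
    exact (hprop.mul continuous_const).mul hprop.matrix_conjTranspose
  exact Integrable.of_bound (hc.matrix_elem a b).aestronglyMeasurable ‖X‖ <|
    Eventually.of_forall fun p =>
      (norm_entry_le_l2_opNorm _ _ _).trans (norm_evolve_interaction_le hH α t p X)

lemma integral_interaction_conj {E : Type*} [NormedAddCommGroup E] [NormedSpace ℝ E]
    {W : Matrix n n ℂ} (hW : W ∈ Matrix.unitaryGroup n ℂ) (f : Matrix n n ℂ → E) :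
    ∫ p, f (W * interaction p * Wᴴ) ∂interactionLaw n
      = ∫ p, f (interaction p) ∂interactionLaw n := by
  set w : Matrix.unitaryGroup n ℂ := ⟨W, hW⟩
  set shift := (MeasurableEquiv.mulLeft w).prodCongr (MeasurableEquiv.refl (n → ℝ))
  have hshift : MeasurePreserving shift (interactionLaw n) (interactionLaw n) :=
    (measurePreserving_mul_left (haarUnitary n) w).prod (MeasurePreserving.id _)
  have interaction_shift : ∀ p, interaction (shift p) = W * interaction p * Wᴴ := fun p => by
    change (W * (p.1 : Matrix n n ℂ)) * realDiagonal p.2 * (W * (p.1 : Matrix n n ℂ))ᴴ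
      = W * ((p.1 : Matrix n n ℂ) * realDiagonal p.2 * (p.1 : Matrix n n ℂ)ᴴ) * Wᴴ
    simp only [Matrix.conjTranspose_mul, mul_assoc]
  simp only [← interaction_shift]
  exact hshift.integral_comp' fun p => f (interaction p)

lemma averageEvolve_conj {H : Matrix n n ℂ} (hH : H.IsHermitian) (α t : ℝ)
    {W : Matrix n n ℂ} (hW : W ∈ Matrix.unitaryGroup n ℂ) (X : Matrix n n ℂ) :
    averageEvolve (W * H * Wᴴ) α t (W * X * Wᴴ) = W * averageEvolve H α t X * Wᴴ := by
  ext a b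
  rw [averageEvolve, Matrix.of_apply, ← integral_interaction_conj hW fun G =>
    evolve (W * H * Wᴴ) G α t (W * X * Wᴴ) a b]
  simp only [evolve_conj _ _ _ _ hW]
  exact integral_mul_mul_apply (integrable_evolve hH α t X) W Wᴴ a b

lemma integrable_normSq_propagator {H : Matrix n n ℂ} (hH : H.IsHermitian) (α t : ℝ) (a b : n) :
    Integrable (fun p => ‖propagator (H + (α : ℂ) • interaction p) t a b‖ ^ 2)
      (interactionLaw n) := by
  refine Integrable.of_bound
    (((continuous_propagator_interaction H α t).matrix_elem a b).norm.pow 2).aestronglyMeasurable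
    1 (Eventually.of_forall fun p => ?_)
  rw [Real.norm_of_nonneg (by positivity)]
  exact pow_le_one₀ (norm_nonneg _) ((norm_entry_le_l2_opNorm _ _ _).trans
    (norm_propagator_le_one (isHermitian_add_smul_interaction hH α p) t))

lemma transitionMatrix_mem_doublyStochastic (E : n → ℝ) (α t : ℝ) :
    transitionMatrix E α t ∈ doublyStochastic ℝ n := by
  have hH := isHermitian_realDiagonal E
  have hint := integrable_normSq_propagator hH α t
  have hU p := propagator_mem_unitaryGroup (isHermitian_add_smul_interaction hH α p) t
  refine mem_doublyStochastic_iff_sum.2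
    ⟨fun a b => integral_nonneg fun _ => by positivity, fun a => ?_, fun b => ?_⟩
  · simp only [transitionMatrix, Matrix.of_apply]
    rw [← integral_finsetSum _ fun b _ => hint a b]
    simp only [fun p => sum_normSq_row (hU p) a]
    simp
  · simp only [transitionMatrix, Matrix.of_apply]
    rw [← integral_finsetSum _ fun a _ => hint a b]
    simp only [fun p => sum_normSq_col (hU p) b]
    simp

lemma diagonal_conj_diagonal {v : n → ℂ} (hv : ∀ i, ‖v i‖ = 1) (x : n → ℂ) :
    Matrix.diagonal v * Matrix.diagonal x * (Matrix.diagonal v)ᴴ = Matrix.diagonal x := by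
  rw [Matrix.diagonal_conjTranspose, Matrix.diagonal_mul_diagonal, Matrix.diagonal_mul_diagonal]
  congr 1 with i
  rw [Pi.star_apply, mul_right_comm, RCLike.star_def, Complex.mul_conj', hv]
  simp

/-- Flipping the sign of the level `a` leaves the Hamiltonian, the state and the law of the
interaction invariant, but changes the sign of the coherence between `a` and `b`. -/
lemma averageEvolve_realDiagonal_apply_of_ne (E : n → ℝ) (α t : ℝ) (x : n → ℝ) {a b : n}
    (hab : a ≠ b) : averageEvolve (realDiagonal E) α t (realDiagonal x) a b = 0 := by
  set v : n → ℂ := fun i => if i = a then -1 else 1 with hv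
  have norm_v : ∀ i, ‖v i‖ = 1 := fun i => by simp only [hv]; split_ifs <;> simp
  have covariance := averageEvolve_conj (isHermitian_realDiagonal E) α t
    (diagonal_mem_unitaryGroup norm_v) (realDiagonal x)
  rw [realDiagonal, realDiagonal, diagonal_conj_diagonal norm_v, diagonal_conj_diagonal norm_v]
    at covariance
  have flip := congrFun₂ covariance a b
  rw [Matrix.diagonal_conjTranspose, Matrix.mul_diagonal, Matrix.diagonal_mul] at flip
  simp only [hv, Pi.star_apply, if_true, if_neg (Ne.symm hab), star_one, mul_one, neg_mul,
    one_mul] at flip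
  exact self_eq_neg.1 flip

lemma averageEvolve_realDiagonal_apply_self (E : n → ℝ) (α t : ℝ) (x : n → ℝ) (a : n) :
    averageEvolve (realDiagonal E) α t (realDiagonal x) a a
      = ((transitionMatrix E α t *ᵥ x) a : ℝ) := by
  have hH := isHermitian_realDiagonal E
  have population : ∀ p, evolve (realDiagonal E) (interaction p) α t (realDiagonal x) a a
      = ((∑ b, ‖propagator (realDiagonal E + (α : ℂ) • interaction p) t a b‖ ^ 2 * x b : ℝ) : ℂ) :=
    fun p => by
      rw [evolve_eq_propagator hH, Matrix.mul_apply]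
      push_cast
      refine Finset.sum_congr rfl fun c _ => ?_
      rw [mul_realDiagonal_apply, Matrix.conjTranspose_apply, mul_right_comm, RCLike.star_def,
        Complex.mul_conj']
  simp only [averageEvolve, Matrix.of_apply, population]
  rw [integral_complex_ofReal, integral_finsetSum _ fun b _ =>
    (integrable_normSq_propagator hH α t a b).mul_const _]
  simp only [integral_mul_const, transitionMatrix, Matrix.mulVec, dotProduct, Matrix.of_apply]

lemma averageEvolve_realDiagonal (E : n → ℝ) (α t : ℝ) (x : n → ℝ) :
    averageEvolve (realDiagonal E) α t (realDiagonal x)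
      = realDiagonal (transitionMatrix E α t *ᵥ x) := by
  ext a b
  rw [realDiagonal_apply (transitionMatrix E α t *ᵥ x)]
  split_ifs with hab
  · rw [← hab, averageEvolve_realDiagonal_apply_self]
  · exact averageEvolve_realDiagonal_apply_of_ne E α t x hab

end Average

/-! ### Bounds on the transition probabilities -/

lemma norm_sq_le_two_mul_of_norm_sub_le {E : Type*} [SeminormedAddCommGroup E] {u z : E} {r : ℝ}
    (h : ‖u - z‖ ≤ r) : ‖u‖ ^ 2 ≤ 2 * ‖z‖ ^ 2 + 2 * r ^ 2 :=
  calc ‖u‖ ^ 2 ≤ (‖z‖ + r) ^ 2 := by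
        gcongr
        exact (norm_le_norm_add_norm_sub' u z).trans (add_le_add_right h _)
    _ ≤ 2 * (‖z‖ ^ 2 + r ^ 2) := add_sq_le
    _ = 2 * ‖z‖ ^ 2 + 2 * r ^ 2 := mul_add _ _ _

section TransitionBounds

open scoped Matrix.Norms.L2Operator

variable {n : Type*} [Fintype n] [DecidableEq n]

/-- The fourth moment of the norm of the random interaction. -/
def fourthMoment (n : Type*) [Fintype n] [DecidableEq n] : ℝ :=
  ∫ p, ‖interaction p‖ ^ 4 ∂interactionLaw n

lemma fourthMoment_nonneg (n : Type*) [Fintype n] [DecidableEq n] : 0 ≤ fourthMoment n :=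
  integral_nonneg fun _ => by positivity

lemma normSq_propagator_first_order (E : n → ℝ) (α : ℝ) {t : ℝ} (ht : 0 ≤ t) {a b : n}
    (hab : a ≠ b) (p : Matrix.unitaryGroup n ℂ × (n → ℝ)) :
    ‖propagator (realDiagonal E + (α : ℂ) • interaction p) t a b‖ ^ 2
        ≤ 2 * (α * t * Real.sinc ((E a - E b) * t / 2)) ^ 2 * ‖interaction p a b‖ ^ 2
          + 2 * (α * t) ^ 4 * ‖interaction p‖ ^ 4 ∧
      (α * t * Real.sinc ((E a - E b) * t / 2)) ^ 2 * ‖interaction p a b‖ ^ 2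
        ≤ 2 * ‖propagator (realDiagonal E + (α : ℂ) • interaction p) t a b‖ ^ 2
          + 2 * (α * t) ^ 4 * ‖interaction p‖ ^ 4 := by
  set V := (α : ℂ) • interaction p with hV
  set z := Complex.I * V a b * phaseIntegral (E a - E b) t with hz
  have remainder :=
    norm_interactionPicture_sub_first_order_le E (isHermitian_smul_interaction α p) ht a b
  rw [Matrix.sub_apply, Matrix.one_apply_ne hab, sub_zero] at remainder
  have normSq_z : ‖z‖ ^ 2
      = (α * t * Real.sinc ((E a - E b) * t / 2)) ^ 2 * ‖interaction p a b‖ ^ 2 := by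
    rw [hz, hV, norm_mul, norm_mul, norm_phaseIntegral, Matrix.smul_apply, norm_smul,
      Complex.norm_I, Complex.norm_real, Real.norm_eq_abs]
    simp only [mul_pow, sq_abs]
    ring
  have remainder_sq : ((‖V‖ * t) ^ 2) ^ 2 = (α * t) ^ 4 * ‖interaction p‖ ^ 4 := by
    rw [hV, norm_smul, Complex.norm_real, Real.norm_eq_abs, ← pow_mul, mul_pow, mul_pow,
      Even.pow_abs (by decide), mul_pow]
    ring
  have upper := norm_sq_le_two_mul_of_norm_sub_le remainder
  have lower := norm_sq_le_two_mul_of_norm_sub_le ((norm_sub_rev _ _).trans_le remainder)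
  rw [norm_interactionPicture_apply, normSq_z, remainder_sq] at upper lower
  constructor <;> linarith

lemma transitionMatrix_le (E : n → ℝ) (α : ℝ) {t : ℝ} (ht : 0 ≤ t) {a b : n} (hab : a ≠ b) :
    transitionMatrix E α t a b
      ≤ 2 * (α * t * Real.sinc ((E a - E b) * t / 2)) ^ 2 / (Fintype.card n + 1)
        + 2 * (α * t) ^ 4 * fourthMoment n := by
  have hG := (integrable_normSq_interaction_apply a b).const_mul
    (2 * (α * t * Real.sinc ((E a - E b) * t / 2)) ^ 2)
  have hK := (integrable_norm_interaction_pow_four (n := n)).const_mul (2 * (α * t) ^ 4)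
  rw [div_eq_mul_one_div, ← integral_normSq_interaction_apply hab, fourthMoment,
    ← integral_const_mul, ← integral_const_mul, ← integral_add hG hK]
  exact integral_mono (integrable_normSq_propagator (isHermitian_realDiagonal E) α t a b)
    (hG.add hK) fun p => (normSq_propagator_first_order E α ht hab p).1

lemma le_transitionMatrix (E : n → ℝ) (α : ℝ) {t : ℝ} (ht : 0 ≤ t) {a b : n} (hab : a ≠ b) :
    (α * t * Real.sinc ((E a - E b) * t / 2)) ^ 2 / (Fintype.card n + 1) / 2
        - (α * t) ^ 4 * fourthMoment n
      ≤ transitionMatrix E α t a b := by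
  have hG := (integrable_normSq_interaction_apply a b).const_mul
    ((α * t * Real.sinc ((E a - E b) * t / 2)) ^ 2)
  have hP := (integrable_normSq_propagator (isHermitian_realDiagonal E) α t a b).const_mul 2
  have hK := (integrable_norm_interaction_pow_four (n := n)).const_mul (2 * (α * t) ^ 4)
  have averaged := integral_mono hG (hP.add hK)
    fun p => (normSq_propagator_first_order E α ht hab p).2
  simp only [Pi.add_apply] at averaged
  rw [integral_add hP hK, integral_const_mul, integral_const_mul, integral_const_mul,
    integral_normSq_interaction_apply hab, mul_one_div] at averaged
  change _ ≤ 2 * transitionMatrix E α t a b + 2 * (α * t) ^ 4 * fourthMoment n at averaged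
  linarith

end TransitionBounds

/-! ### The channel on populations -/

section Gibbs

variable {n : Type*} [Fintype n]

/-- The Boltzmann distribution of the levels `e` at inverse temperature `β`. -/
def boltzmann (e : n → ℝ) (β : ℝ) : n → ℝ :=
  fun i => Real.exp (-β * e i) / ∑ j, Real.exp (-β * e j)

lemma boltzmann_mem_stdSimplex [Nonempty n] (e : n → ℝ) (β : ℝ) :
    boltzmann e β ∈ stdSimplex ℝ n := by
  refine ⟨fun i => by unfold boltzmann; positivity, ?_⟩
  have : (0 : ℝ) < ∑ j, Real.exp (-β * e j) :=
    Finset.sum_pos (fun j _ => Real.exp_pos _) Finset.univ_nonempty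
  simp only [boltzmann, ← Finset.sum_div]
  exact div_self this.ne'

variable [DecidableEq n]

lemma gibbs_realDiagonal (e : n → ℝ) (β : ℝ) :
    gibbs (realDiagonal e) β = realDiagonal (boltzmann e β) := by
  have exp_diagonal : NormedSpace.exp (-(β : ℂ) • realDiagonal e)
      = Matrix.diagonal fun i => ((Real.exp (-β * e i) : ℝ) : ℂ) := by
    rw [realDiagonal, ← Matrix.diagonal_smul, Matrix.exp_diagonal]
    congr 1 with i
    rw [Pi.coe_exp, ← Complex.exp_eq_exp_ℂ]
    simp
  rw [gibbs, exp_diagonal, Matrix.trace_diagonal, ← Matrix.diagonal_smul, realDiagonal]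
  congr 1 with i
  rw [Pi.smul_apply, smul_eq_mul, boltzmann]
  push_cast
  rw [div_eq_inv_mul]

lemma gibbs_unitary_conj {V : Matrix n n ℂ} (hV : V ∈ Matrix.unitaryGroup n ℂ)
    (A : Matrix n n ℂ) (β : ℝ) : gibbs (V * A * Vᴴ) β = V * gibbs A β * Vᴴ := by
  have cancel : Vᴴ * V = 1 := Matrix.mem_unitaryGroup_iff'.1 hV
  have exp_conj : NormedSpace.exp (-(β : ℂ) • (V * A * Vᴴ))
      = V * NormedSpace.exp (-(β : ℂ) • A) * Vᴴ := by
    rw [← exp_unitary_conj hV, mul_smul_comm, smul_mul_assoc]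
  rw [gibbs, gibbs, exp_conj, Matrix.trace_mul_comm, ← mul_assoc, cancel, one_mul, mul_smul_comm,
    smul_mul_assoc]

end Gibbs

section TensorProduct

variable {n m : Type*}

/-- The levels of the uncoupled Hamiltonian of a system with levels `e` and an environment with
levels `h`. -/
def uncoupledLevels (e : n → ℝ) (h : m → ℝ) : n × m → ℝ := fun x => e x.1 + h x.2

lemma realDiagonal_kronecker_realDiagonal [DecidableEq n] [DecidableEq m] (p : n → ℝ)
    (q : m → ℝ) :
    realDiagonal p ⊗ₖ realDiagonal q = realDiagonal fun x : n × m => p x.1 * q x.2 := by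
  simp [realDiagonal, Matrix.diagonal_kronecker_diagonal]

lemma totalHamiltonian_realDiagonal [DecidableEq n] [DecidableEq m] (e : n → ℝ) (h : m → ℝ) :
    totalHamiltonian (realDiagonal e) (realDiagonal h) = realDiagonal (uncoupledLevels e h) := by
  simp only [totalHamiltonian, realDiagonal, ← Matrix.diagonal_one,
    Matrix.diagonal_kronecker_diagonal, Matrix.diagonal_add, one_mul, mul_one, uncoupledLevels,
    Complex.ofReal_add]

lemma totalHamiltonian_unitary_conj [Fintype n] [DecidableEq n] [Fintype m] [DecidableEq m]
    {V : Matrix n n ℂ} (hV : V ∈ Matrix.unitaryGroup n ℂ) (HS : Matrix n n ℂ)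
    (HE : Matrix m m ℂ) :
    totalHamiltonian (V * HS * Vᴴ) HE
      = (V ⊗ₖ (1 : Matrix m m ℂ)) * totalHamiltonian HS HE * (V ⊗ₖ (1 : Matrix m m ℂ))ᴴ := by
  have cancel : V * Vᴴ = 1 := Matrix.mem_unitaryGroup_iff.1 hV
  simp only [totalHamiltonian, mul_add, add_mul, Matrix.conjTranspose_kronecker,
    Matrix.conjTranspose_one, ← Matrix.mul_kronecker_mul, mul_one, one_mul, cancel]

lemma partialTraceEnv_conj [Fintype n] [Fintype m] [DecidableEq m] (V : Matrix n n ℂ)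
    (Y : Matrix (n × m) (n × m) ℂ) :
    partialTraceEnv ((V ⊗ₖ (1 : Matrix m m ℂ)) * Y * (V ⊗ₖ (1 : Matrix m m ℂ))ᴴ)
      = V * partialTraceEnv Y * Vᴴ := by
  ext i j
  simp only [partialTraceEnv, Matrix.of_apply, Matrix.mul_apply, Fintype.sum_prod_type,
    Matrix.conjTranspose_kronecker, Matrix.conjTranspose_one, Matrix.kronecker_apply,
    Matrix.one_apply, mul_ite, mul_one, mul_zero, ite_mul, zero_mul, Finset.sum_ite_eq,
    Finset.sum_ite_eq', Finset.mem_univ, if_true]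
  rw [Finset.sum_comm]
  refine Finset.sum_congr rfl fun c _ => ?_
  simp only [Finset.mul_sum, Finset.sum_mul]
  rw [Finset.sum_comm]

lemma partialTraceEnv_realDiagonal [DecidableEq n] [Fintype m] [DecidableEq m] (x : n × m → ℝ) :
    partialTraceEnv (realDiagonal x) = realDiagonal fun i => ∑ k, x (i, k) := by
  ext i j
  simp only [partialTraceEnv, Matrix.of_apply, realDiagonal_apply, Prod.mk.injEq, and_true]
  split_ifs <;> simp

end TensorProduct

section Populations

variable {n m : Type*} [Fintype n] [Fintype m]

/-- The transition matrix of the system when system and environment jump according to `P` and the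
environment is prepared in the distribution `q` and discarded afterwards. -/
def reducedMatrix (P : Matrix (n × m) (n × m) ℝ) (q : m → ℝ) : Matrix n n ℝ :=
  Matrix.of fun i j => ∑ k, ∑ l, P (i, k) (j, l) * q l

lemma reducedMatrix_mulVec (P : Matrix (n × m) (n × m) ℝ) (q : m → ℝ) (p : n → ℝ) :
    reducedMatrix P q *ᵥ p = fun i => ∑ k, (P *ᵥ fun x => p x.1 * q x.2) (i, k) := by
  ext i
  simp only [reducedMatrix, Matrix.mulVec, dotProduct, Matrix.of_apply, Fintype.sum_prod_type,
    Finset.sum_mul]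
  rw [Finset.sum_comm]
  exact Finset.sum_congr rfl fun k _ => Finset.sum_congr rfl fun j _ =>
    Finset.sum_congr rfl fun l _ => by ring

variable [DecidableEq n] [DecidableEq m]

lemma reducedMatrix_mem_colStochastic {P : Matrix (n × m) (n × m) ℝ}
    (hP : P ∈ Matrix.colStochastic ℝ (n × m)) {q : m → ℝ} (hq : q ∈ stdSimplex ℝ m) :
    reducedMatrix P q ∈ Matrix.colStochastic ℝ n := by
  obtain ⟨P_nonneg, P_sum⟩ := Matrix.mem_colStochastic_iff_sum.1 hP
  refine Matrix.mem_colStochastic_iff_sum.2 ⟨fun i j => Finset.sum_nonneg fun k _ =>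
    Finset.sum_nonneg fun l _ => mul_nonneg (P_nonneg _ _) (hq.1 l), fun j => ?_⟩
  calc ∑ i, reducedMatrix P q i j = ∑ l, (∑ x, P x (j, l)) * q l := by
        simp only [Finset.sum_mul]
        exact (Fintype.sum_prod_type fun x => ∑ l, P x (j, l) * q l).symm.trans Finset.sum_comm
    _ = 1 := by simp only [P_sum, one_mul, hq.2]

lemma channel_unitary_conj {V : Matrix n n ℂ} (hV : V ∈ Matrix.unitaryGroup n ℂ) (e : n → ℝ)
    (h : m → ℝ) (α β t : ℝ) (p : n → ℝ) :
    channel (V * realDiagonal e * Vᴴ) (realDiagonal h) α β t (V * realDiagonal p * Vᴴ)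
      = V * realDiagonal
          (reducedMatrix (transitionMatrix (uncoupledLevels e h) α t) (boltzmann h β) *ᵥ p)
        * Vᴴ := by
  have hW : V ⊗ₖ (1 : Matrix m m ℂ) ∈ Matrix.unitaryGroup (n × m) ℂ :=
    Matrix.kronecker_mem_unitary hV (one_mem _)
  have initial : (V * realDiagonal p * Vᴴ) ⊗ₖ realDiagonal (boltzmann h β)
      = (V ⊗ₖ (1 : Matrix m m ℂ)) * realDiagonal (fun x : n × m => p x.1 * boltzmann h β x.2)
        * (V ⊗ₖ (1 : Matrix m m ℂ))ᴴ := by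
    rw [← realDiagonal_kronecker_realDiagonal, Matrix.conjTranspose_kronecker,
      Matrix.conjTranspose_one, ← Matrix.mul_kronecker_mul, ← Matrix.mul_kronecker_mul, one_mul,
      mul_one]
  change partialTraceEnv (averageEvolve (totalHamiltonian (V * realDiagonal e * Vᴴ)
    (realDiagonal h)) α t ((V * realDiagonal p * Vᴴ) ⊗ₖ gibbs (realDiagonal h) β)) = _
  rw [gibbs_realDiagonal, initial, totalHamiltonian_unitary_conj hV, totalHamiltonian_realDiagonal,
    averageEvolve_conj (isHermitian_realDiagonal _) α t hW, averageEvolve_realDiagonal,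
    partialTraceEnv_conj, partialTraceEnv_realDiagonal, reducedMatrix_mulVec]

lemma channel_iterate_unitary_conj {V : Matrix n n ℂ} (hV : V ∈ Matrix.unitaryGroup n ℂ)
    (e : n → ℝ) (h : m → ℝ) (α β t : ℝ) (p : n → ℝ) (L : ℕ) :
    (channel (V * realDiagonal e * Vᴴ) (realDiagonal h) α β t)^[L] (V * realDiagonal p * Vᴴ)
      = V * realDiagonal
          (reducedMatrix (transitionMatrix (uncoupledLevels e h) α t) (boltzmann h β) ^ L *ᵥ p)
        * Vᴴ := by
  induction L with
  | zero => simp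
  | succ L ih =>
    rw [Function.iterate_succ_apply', ih, channel_unitary_conj hV, Matrix.mulVec_mulVec, pow_succ']

end Populations

/-! ### Diagonalization and the trace norm -/

section Diagonalization

variable {n : Type*} [Fintype n] [DecidableEq n]

lemma exists_unitary_conj_realDiagonal {A : Matrix n n ℂ} (hA : A.IsHermitian)
    (σ : Equiv.Perm n) :
    ∃ V ∈ Matrix.unitaryGroup n ℂ, A = V * realDiagonal (hA.eigenvalues ∘ σ) * Vᴴ := by
  set U := (hA.eigenvectorUnitary : Matrix n n ℂ)
  have hU : U * Uᴴ = 1 := Matrix.mem_unitaryGroup_iff.1 hA.eigenvectorUnitary.2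
  refine ⟨U.submatrix id σ, Matrix.mem_unitaryGroup_iff.2 ?_, ?_⟩
  · rw [Matrix.star_eq_conjTranspose, Matrix.conjTranspose_submatrix, Matrix.submatrix_mul_equiv,
      hU, Matrix.submatrix_id_id]
  · have permuted : realDiagonal (hA.eigenvalues ∘ σ)
        = (realDiagonal hA.eigenvalues).submatrix σ σ := by
      rw [realDiagonal, realDiagonal, Matrix.submatrix_diagonal_equiv]
      rfl
    rw [permuted, Matrix.conjTranspose_submatrix, Matrix.submatrix_mul_equiv,
      Matrix.submatrix_mul_equiv, Matrix.submatrix_id_id]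
    exact hA.spectral_theorem

lemma map_eigenvalues_of_eq_unitary_conj {A V : Matrix n n ℂ} (hA : A.IsHermitian)
    (hV : V ∈ Matrix.unitaryGroup n ℂ) {x : n → ℝ} (h : A = V * realDiagonal x * Vᴴ) :
    Finset.univ.val.map hA.eigenvalues = Finset.univ.val.map x := by
  have cancel : Vᴴ * V = 1 := Matrix.mem_unitaryGroup_iff'.1 hV
  have charpoly : A.charpoly = ∏ i, (Polynomial.X - Polynomial.C (x i : ℂ)) := by
    rw [h, Matrix.charpoly_mul_comm, ← mul_assoc, cancel, one_mul, realDiagonal,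
      Matrix.charpoly_diagonal]
  have roots := hA.roots_charpoly_eq_eigenvalues
  rw [charpoly, Polynomial.roots_prod _ _
    (Finset.prod_ne_zero_iff.2 fun i _ => Polynomial.X_sub_C_ne_zero _)] at roots
  have real_parts := congrArg (Multiset.map Complex.re) roots
  simp only [Polynomial.roots_X_sub_C, Multiset.bind_singleton, Multiset.map_map] at real_parts
  exact real_parts.symm

lemma traceNorm_unitary_conj {V : Matrix n n ℂ} (hV : V ∈ Matrix.unitaryGroup n ℂ)
    (x : n → ℝ) : traceNorm (V * realDiagonal x * Vᴴ) = ∑ i, |x i| := by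
  have gram : (V * realDiagonal x * Vᴴ)ᴴ * (V * realDiagonal x * Vᴴ)
      = V * realDiagonal (fun i => x i * x i) * Vᴴ := by
    rw [Matrix.conjTranspose_mul, Matrix.conjTranspose_mul, Matrix.conjTranspose_conjTranspose,
      (isHermitian_realDiagonal x).eq, ← mul_assoc V, unitary_conj_mul_conj hV, realDiagonal,
      Matrix.diagonal_mul_diagonal]
    simp only [realDiagonal, Complex.ofReal_mul]
  have singular_values := congrArg (fun s => (s.map Real.sqrt).sum)
    (map_eigenvalues_of_eq_unitary_conj (Matrix.isHermitian_conjTranspose_mul_self _) hV gram)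
  simp only [Multiset.map_map, Function.comp_def, Real.sqrt_mul_self_eq_abs] at singular_values
  exact singular_values

lemma apply_eq_zero_of_commute_realDiagonal {e : n → ℝ} {τ : Matrix n n ℂ}
    (h : Commute τ (realDiagonal e)) {i j : n} (hij : e i ≠ e j) : τ i j = 0 := by
  have entry := congrFun₂ h.eq i j
  rw [mul_realDiagonal_apply, realDiagonal, Matrix.diagonal_mul] at entry
  refine (mul_eq_zero.1 (?_ : ((e i : ℂ) - e j) * τ i j = 0)).resolve_left
    (sub_ne_zero.2 (Complex.ofReal_injective.ne hij))
  linear_combination -entry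

lemma IsDensityMatrix.exists_eq_realDiagonal {τ : Matrix n n ℂ} (hτ : IsDensityMatrix τ)
    (hd : ∀ i j, i ≠ j → τ i j = 0) : ∃ p ∈ stdSimplex ℝ n, τ = realDiagonal p := by
  have diag_nonneg : ∀ i, 0 ≤ τ i i := fun i => hτ.1.diag_nonneg
  refine ⟨fun i => (τ i i).re, ⟨fun i => (Complex.nonneg_iff.1 (diag_nonneg i)).1, ?_⟩, ?_⟩
  · simpa [Matrix.trace] using congrArg Complex.re hτ.2
  · ext i j
    rw [realDiagonal_apply]
    split_ifs with hij
    · exact hij ▸ Complex.eq_re_of_ofReal_le (diag_nonneg i)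
    · exact hd i j hij

lemma IsDensityMatrix.exists_eq_unitary_conj_of_commute {V ρ : Matrix n n ℂ}
    (hV : V ∈ Matrix.unitaryGroup n ℂ) {e : n → ℝ} (he : Function.Injective e)
    (hρ : IsDensityMatrix ρ)
    (hc : Commute ρ (V * realDiagonal e * Vᴴ)) :
    ∃ p ∈ stdSimplex ℝ n, ρ = V * realDiagonal p * Vᴴ := by
  have hVV : V * Vᴴ = 1 := Matrix.mem_unitaryGroup_iff.1 hV
  have cancel : Vᴴ * V = 1 := Matrix.mem_unitaryGroup_iff'.1 hV
  have density : IsDensityMatrix (Vᴴ * ρ * V) :=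
    ⟨hρ.1.conjTranspose_mul_mul_same V, by
      rw [Matrix.trace_mul_comm, ← mul_assoc, hVV, one_mul, hρ.2]⟩
  have commute : Commute (Vᴴ * ρ * V) (realDiagonal e) := by
    have conj_mul := unitary_conj_mul_conj (Unitary.star_mem hV)
    simp only [Matrix.star_eq_conjTranspose, Matrix.conjTranspose_conjTranspose] at conj_mul
    have spectrum : realDiagonal e = Vᴴ * (V * realDiagonal e * Vᴴ) * V := by
      rw [← mul_assoc, ← mul_assoc, cancel, one_mul, mul_assoc, cancel, mul_one]
    rw [spectrum, commute_iff_eq, conj_mul, conj_mul, hc.eq]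
  obtain ⟨p, hp, hτ⟩ := density.exists_eq_realDiagonal fun i j hij =>
    apply_eq_zero_of_commute_realDiagonal commute (he.ne hij)
  refine ⟨p, hp, ?_⟩
  calc ρ = (V * Vᴴ) * ρ * (V * Vᴴ) := by rw [hVV, one_mul, mul_one]
    _ = V * (Vᴴ * ρ * V) * Vᴴ := by simp only [mul_assoc]
    _ = V * realDiagonal p * Vᴴ := by rw [hτ]

end Diagonalization

/-! ### Two-level Markov chains -/

section TwoLevelChain

lemma sum_abs_sub_of_mem_stdSimplex {p q : Fin 2 → ℝ} (hp : p ∈ stdSimplex ℝ (Fin 2))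
    (hq : q ∈ stdSimplex ℝ (Fin 2)) : ∑ i, |p i - q i| = 2 * |q 1 - p 1| := by
  have sum_p := hp.2
  have sum_q := hq.2
  rw [Fin.sum_univ_two] at sum_p sum_q ⊢
  rw [show p 0 - q 0 = q 1 - p 1 by linarith, abs_sub_comm (p 1)]
  ring

lemma mulVec_mem_stdSimplex {n : Type*} [Fintype n] [DecidableEq n] {R : Matrix n n ℝ}
    (hR : R ∈ Matrix.colStochastic ℝ n) {p : n → ℝ} (hp : p ∈ stdSimplex ℝ n) :
    R *ᵥ p ∈ stdSimplex ℝ n :=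
  ⟨fun _ => Matrix.nonneg_mulVec_of_mem_colStochastic hR hp.1 _, by
    rw [Matrix.sum_mulVec_of_mem_colStochastic hR, hp.2]⟩

lemma mulVec_one_sub_eq {R : Matrix (Fin 2) (Fin 2) ℝ} (hR : R ∈ Matrix.colStochastic ℝ (Fin 2))
    {p q : Fin 2 → ℝ} (hp : p ∈ stdSimplex ℝ (Fin 2)) (hq : q ∈ stdSimplex ℝ (Fin 2)) :
    (R *ᵥ p) 1 - q 1
      = (1 - (R 1 0 + R 0 1)) * (p 1 - q 1) + (R 1 0 * q 0 - R 0 1 * q 1) := by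
  have col := Matrix.sum_col_of_mem_colStochastic hR 1
  have sum_p := hp.2
  have sum_q := hq.2
  simp only [Matrix.mulVec, dotProduct, Fin.sum_univ_two] at *
  linear_combination p 1 * col + R 1 0 * (sum_p - sum_q)

lemma abs_pow_mulVec_sub_le_of_detailed_balance {R : Matrix (Fin 2) (Fin 2) ℝ}
    (hR : R ∈ Matrix.colStochastic ℝ (Fin 2)) {p q : Fin 2 → ℝ}
    (hp : p ∈ stdSimplex ℝ (Fin 2)) (hq : q ∈ stdSimplex ℝ (Fin 2)) {r δ : ℝ} (hr : 0 < r)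
    (hr' : r ≤ R 1 0 + R 0 1) (hle : R 1 0 + R 0 1 ≤ 1)
    (hδ : |R 1 0 * q 0 - R 0 1 * q 1| ≤ δ) (L : ℕ) :
    |(R ^ L *ᵥ p) 1 - q 1| ≤ (1 - r) ^ L * |p 1 - q 1| + δ / r := by
  have δ_nonneg : 0 ≤ δ := (abs_nonneg _).trans hδ
  induction L with
  | zero => simpa using div_nonneg δ_nonneg hr.le
  | succ L ih =>
    have step := mulVec_one_sub_eq hR (mulVec_mem_stdSimplex (pow_mem hR L) hp) hq
    rw [Matrix.mulVec_mulVec, ← pow_succ'] at step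
    calc |(R ^ (L + 1) *ᵥ p) 1 - q 1|
        ≤ |(1 - (R 1 0 + R 0 1)) * ((R ^ L *ᵥ p) 1 - q 1)| + |R 1 0 * q 0 - R 0 1 * q 1| := by
          rw [step]
          exact abs_add_le _ _
      _ ≤ (1 - r) * |(R ^ L *ᵥ p) 1 - q 1| + δ := by
          rw [abs_mul, abs_of_nonneg (by linarith : 0 ≤ 1 - (R 1 0 + R 0 1))]
          gcongr
      _ ≤ (1 - r) * ((1 - r) ^ L * |p 1 - q 1| + δ / r) + δ := by
          gcongr
          linarith
      _ = (1 - r) ^ (L + 1) * |p 1 - q 1| + δ / r := by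
          field_simp
          ring

end TwoLevelChain

section Resonance

variable {P : Matrix (Fin 2 × Fin 2) (Fin 2 × Fin 2) ℝ} {q : Fin 2 → ℝ} {η : ℝ}

lemma abs_resonant_sub_le (hP : P ∈ doublyStochastic ℝ (Fin 2 × Fin 2))
    (hη : ∀ a b, b ≠ a → b ≠ a.swap → P a b ≤ η) :
    |P (1, 0) (0, 1) - P (0, 1) (1, 0)| ≤ 2 * η := by
  have row := sum_row_of_mem_doublyStochastic hP (0, 1)
  have col := sum_col_of_mem_doublyStochastic hP (0, 1)
  have nonneg := fun a b => nonneg_of_mem_doublyStochastic hP (i := a) (j := b)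
  simp only [Fintype.sum_prod_type, Fin.sum_univ_two] at row col
  rw [abs_le]
  constructor
  · linarith [hη (0, 0) (0, 1) (by decide) (by decide), hη (1, 1) (0, 1) (by decide) (by decide),
      nonneg (0, 1) (0, 0), nonneg (0, 1) (1, 1)]
  · linarith [hη (0, 1) (0, 0) (by decide) (by decide), hη (0, 1) (1, 1) (by decide) (by decide),
      nonneg (0, 0) (0, 1), nonneg (1, 1) (0, 1)]

lemma reducedMatrix_mem_Icc_of_ne (hP : ∀ a b, 0 ≤ P a b)
    (hη : ∀ a b, b ≠ a → b ≠ a.swap → P a b ≤ η) (hq : q ∈ stdSimplex ℝ (Fin 2)) {i j : Fin 2}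
    (hij : i ≠ j) :
    reducedMatrix P q i j ∈ Set.Icc (q i * P (i, j) (j, i)) (q i * P (i, j) (j, i) + 2 * η) := by
  have sum_q := hq.2
  have split : q i + q j = 1 ∧ reducedMatrix P q i j = q i * P (i, j) (j, i)
      + (q i * P (i, i) (j, i) + q j * (P (i, i) (j, j) + P (i, j) (j, j))) := by
    simp only [reducedMatrix, Matrix.of_apply, Fin.sum_univ_two] at sum_q ⊢
    obtain ⟨rfl, rfl⟩ | ⟨rfl, rfl⟩ : i = 0 ∧ j = 1 ∨ i = 1 ∧ j = 0 := by
      revert hij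
      decide +revert
    all_goals exact ⟨by linarith, by ring⟩
  have off : ∀ k l, (k, l) ≠ (j, i) → 0 ≤ P (i, k) (j, l) ∧ P (i, k) (j, l) ≤ η :=
    fun k l hkl => ⟨hP _ _, hη _ _ (by simp [hij.symm]) (by grind)⟩
  obtain ⟨h_nonneg₁, h_le₁⟩ := off i i (by simp [hij])
  obtain ⟨h_nonneg₂, h_le₂⟩ := off i j (by simp [hij])
  obtain ⟨h_nonneg₃, h_le₃⟩ := off j j (by simp [hij.symm])
  have qi_nonneg := hq.1 i
  have qj_nonneg := hq.1 j
  rw [split.2, Set.mem_Icc, le_add_iff_nonneg_right, add_le_add_iff_left]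
  refine ⟨by positivity, ?_⟩
  calc q i * P (i, i) (j, i) + q j * (P (i, i) (j, j) + P (i, j) (j, j))
      ≤ q i * η + q j * (η + η) := by gcongr
    _ = 2 * η - q i * η := by linear_combination 2 * η * split.1
    _ ≤ 2 * η := sub_le_self _ (mul_nonneg qi_nonneg (h_nonneg₁.trans h_le₁))

lemma sub_le_reducedMatrix_add (hP : P ∈ doublyStochastic ℝ (Fin 2 × Fin 2))
    (hη : ∀ a b, b ≠ a → b ≠ a.swap → P a b ≤ η) (hq : q ∈ stdSimplex ℝ (Fin 2)) :
    P (1, 0) (0, 1) - 2 * η ≤ reducedMatrix P q 1 0 + reducedMatrix P q 0 1 := by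
  have nonneg : ∀ a b, 0 ≤ P a b := fun _ _ => nonneg_of_mem_doublyStochastic hP
  have η_nonneg : 0 ≤ η := (nonneg (0, 0) (1, 1)).trans (hη _ _ (by decide) (by decide))
  have excitation := (reducedMatrix_mem_Icc_of_ne nonneg hη hq one_ne_zero).1
  have relaxation := (reducedMatrix_mem_Icc_of_ne nonneg hη hq zero_ne_one).1
  have asymm := (abs_le.1 (abs_resonant_sub_le hP hη)).2
  have q0_nonneg := hq.1 0
  have sum_q := hq.2
  rw [Fin.sum_univ_two] at sum_q
  calc P (1, 0) (0, 1) - 2 * η ≤ P (1, 0) (0, 1) - q 0 * (2 * η) := by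
        linarith [mul_le_of_le_one_left η_nonneg (mem_Icc_of_mem_stdSimplex hq 0).2]
    _ = q 1 * P (1, 0) (0, 1) + q 0 * (P (1, 0) (0, 1) - 2 * η) := by
        linear_combination -P (1, 0) (0, 1) * sum_q
    _ ≤ q 1 * P (1, 0) (0, 1) + q 0 * P (0, 1) (1, 0) := by
        gcongr
        linarith
    _ ≤ _ := add_le_add excitation relaxation

lemma reducedMatrix_add_le (hP : ∀ a b, 0 ≤ P a b)
    (hη : ∀ a b, b ≠ a → b ≠ a.swap → P a b ≤ η) (hq : q ∈ stdSimplex ℝ (Fin 2)) :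
    reducedMatrix P q 1 0 + reducedMatrix P q 0 1
      ≤ P (1, 0) (0, 1) + P (0, 1) (1, 0) + 4 * η := by
  have excitation := (reducedMatrix_mem_Icc_of_ne hP hη hq one_ne_zero).2
  have relaxation := (reducedMatrix_mem_Icc_of_ne hP hη hq zero_ne_one).2
  have q_le_one : ∀ i, q i ≤ 1 := fun i => (mem_Icc_of_mem_stdSimplex hq i).2
  linarith [mul_le_of_le_one_left (hP (1, 0) (0, 1)) (q_le_one 1),
    mul_le_of_le_one_left (hP (0, 1) (1, 0)) (q_le_one 0)]

lemma abs_reducedMatrix_detailed_balance_le (hP : P ∈ doublyStochastic ℝ (Fin 2 × Fin 2))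
    (hη : ∀ a b, b ≠ a → b ≠ a.swap → P a b ≤ η) (hq : q ∈ stdSimplex ℝ (Fin 2)) :
    |reducedMatrix P q 1 0 * q 0 - reducedMatrix P q 0 1 * q 1| ≤ 4 * η := by
  have nonneg : ∀ a b, 0 ≤ P a b := fun _ _ => nonneg_of_mem_doublyStochastic hP
  have excitation := reducedMatrix_mem_Icc_of_ne nonneg hη hq one_ne_zero
  have relaxation := reducedMatrix_mem_Icc_of_ne nonneg hη hq zero_ne_one
  have q_mem := fun i => mem_Icc_of_mem_stdSimplex hq i
  have sum_q := hq.2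
  rw [Fin.sum_univ_two] at sum_q
  set a := P (1, 0) (0, 1)
  set b := P (0, 1) (1, 0)
  set x := reducedMatrix P q 1 0 - q 1 * a
  set y := reducedMatrix P q 0 1 - q 0 * b
  have x_le : |x| ≤ 2 * η := abs_le.2 ⟨by linarith [excitation.1, excitation.2],
    by linarith [excitation.2]⟩
  have y_le : |y| ≤ 2 * η := abs_le.2 ⟨by linarith [relaxation.1, relaxation.2],
    by linarith [relaxation.2]⟩
  calc |reducedMatrix P q 1 0 * q 0 - reducedMatrix P q 0 1 * q 1|
      = |q 0 * q 1 * (a - b) + (q 0 * x - q 1 * y)| := by congr 1; ring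
    _ ≤ q 0 * q 1 * |a - b| + (q 0 * |x| + q 1 * |y|) := by
        refine (abs_add_le _ _).trans (add_le_add ?_ ((abs_sub _ _).trans ?_))
        · rw [abs_mul, abs_of_nonneg (mul_nonneg (q_mem 0).1 (q_mem 1).1)]
        · rw [abs_mul, abs_mul, abs_of_nonneg (q_mem 0).1, abs_of_nonneg (q_mem 1).1]
    _ ≤ 1 * (2 * η) + (q 0 * (2 * η) + q 1 * (2 * η)) := by
        have q0_nonneg := (q_mem 0).1
        have q1_nonneg := (q_mem 1).1
        gcongr
        · exact mul_le_one₀ (q_mem 0).2 q1_nonneg (q_mem 1).2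
        · exact abs_resonant_sub_le hP hη
    _ = 4 * η := by linear_combination 2 * η * sum_q

end Resonance

/-! ### Qubits -/

section Qubit

lemma exists_ordered_diagonalization {HS : Matrix (Fin 2) (Fin 2) ℂ} (hHS : HS.IsHermitian) :
    ∃ V ∈ Matrix.unitaryGroup (Fin 2) ℂ, ∃ e : Fin 2 → ℝ,
      e 1 - e 0 = qubitGap hHS ∧ HS = V * realDiagonal e * Vᴴ := by
  obtain ⟨σ, hσ⟩ : ∃ σ : Equiv.Perm (Fin 2),
      hHS.eigenvalues (σ 1) - hHS.eigenvalues (σ 0) = qubitGap hHS := by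
    rcases le_total (hHS.eigenvalues 0) (hHS.eigenvalues 1) with h | h
    · exact ⟨1, by rw [qubitGap, abs_of_nonpos (by linarith)]; simp⟩
    · exact ⟨Equiv.swap 0 1, by rw [qubitGap, abs_of_nonneg (by linarith)]; simp⟩
  obtain ⟨V, hV, diagonalization⟩ := exists_unitary_conj_realDiagonal hHS σ
  exact ⟨V, hV, _, hσ, diagonalization⟩

lemma envHamiltonian_eq_realDiagonal (γ : ℝ) : envHamiltonian γ = realDiagonal ![0, γ] := by
  ext i j
  fin_cases i <;> fin_cases j <;> simp [envHamiltonian, realDiagonal]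

lemma boltzmann_one_eq_sigmoid (e : Fin 2 → ℝ) (β : ℝ) :
    boltzmann e β 1 = Real.sigmoid (-(β * (e 1 - e 0))) := by
  have ratio : Real.exp (β * (e 1 - e 0)) = Real.exp (-β * e 0) / Real.exp (-β * e 1) := by
    rw [← Real.exp_sub]
    ring_nf
  rw [boltzmann, Fin.sum_univ_two, Real.sigmoid_def, neg_neg, ratio]
  field_simp
  ring

lemma abs_sigmoid_sub_sigmoid_le (x y : ℝ) :
    |Real.sigmoid x - Real.sigmoid y| ≤ |x - y| := by
  have deriv_le_one (z : ℝ) : ‖Real.sigmoid z * (1 - Real.sigmoid z)‖ ≤ 1 := by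
    have nonneg := Real.sigmoid_nonneg z
    have le_one := Real.sigmoid_le_one z
    rw [Real.norm_eq_abs, abs_of_nonneg (mul_nonneg nonneg (by linarith))]
    exact mul_le_one₀ le_one (by linarith) (by linarith)
  simpa using convex_univ.norm_image_sub_le_of_norm_hasDerivWithin_le
    (fun z _ => (Real.hasDerivAt_sigmoid z).hasDerivWithinAt) (fun z _ => deriv_le_one z)
    (Set.mem_univ y) (Set.mem_univ x)

lemma abs_boltzmann_one_sub_le (e h : Fin 2 → ℝ) {β : ℝ} (hβ : 0 ≤ β) :
    |boltzmann e β 1 - boltzmann h β 1| ≤ β * |e 1 - e 0 - (h 1 - h 0)| := by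
  rw [boltzmann_one_eq_sigmoid, boltzmann_one_eq_sigmoid]
  refine (abs_sigmoid_sub_sigmoid_le _ _).trans_eq ?_
  rw [← neg_add', ← sub_eq_add_neg, abs_neg, ← mul_sub, abs_mul, abs_of_nonneg hβ]

/-- The one-interaction transition matrix of the populations of a qubit with levels `e`, coupled to
an environment qubit of gap `γ`. -/
def qubitChain (e : Fin 2 → ℝ) (γ α β t : ℝ) : Matrix (Fin 2) (Fin 2) ℝ :=
  reducedMatrix (transitionMatrix (uncoupledLevels e ![0, γ]) α t) (boltzmann ![0, γ] β)

lemma qubitChain_mem_colStochastic (e : Fin 2 → ℝ) (γ α β t : ℝ) :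
    qubitChain e γ α β t ∈ Matrix.colStochastic ℝ (Fin 2) :=
  reducedMatrix_mem_colStochastic
    (doublyStochastic_eq_rowStochastic_inf_colStochastic.le
      (transitionMatrix_mem_doublyStochastic _ α t)).2 (boltzmann_mem_stdSimplex _ β)

lemma exists_traceNorm_gibbs_sub_iterate_channel {HS ρ : Matrix (Fin 2) (Fin 2) ℂ}
    (hHS : HS.IsHermitian) (hgap : 0 < qubitGap hHS) (hρ : IsDensityMatrix ρ)
    (hc : Commute ρ HS) (γ α β t : ℝ) (L : ℕ) :
    ∃ e : Fin 2 → ℝ, e 1 - e 0 = qubitGap hHS ∧ ∃ p ∈ stdSimplex ℝ (Fin 2),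
      traceNorm (gibbs HS β - (channel HS (envHamiltonian γ) α β t)^[L] ρ)
        = 2 * |(qubitChain e γ α β t ^ L *ᵥ p) 1 - boltzmann e β 1| := by
  obtain ⟨V, hV, e, gap_eq, rfl⟩ := exists_ordered_diagonalization hHS
  have he : Function.Injective e := by
    rw [← gap_eq, sub_pos] at hgap
    exact (Fin.strictMono_iff_lt_succ.2 fun i => by simpa [Subsingleton.elim i 0]).injective
  obtain ⟨p, hp, rfl⟩ := hρ.exists_eq_unitary_conj_of_commute hV he hc
  refine ⟨e, gap_eq, p, hp, ?_⟩
  have final_mem := mulVec_mem_stdSimplex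
    (pow_mem (qubitChain_mem_colStochastic e γ α β t) L) hp
  rw [envHamiltonian_eq_realDiagonal, channel_iterate_unitary_conj hV, gibbs_unitary_conj hV,
    gibbs_realDiagonal, ← qubitChain, ← sub_mul, ← mul_sub, ← realDiagonal_sub,
    traceNorm_unitary_conj hV]
  exact sum_abs_sub_of_mem_stdSimplex (boltzmann_mem_stdSimplex e β) final_mem

end Qubit

/-! ### The window of interaction times -/

section Window

lemma two_thirds_le_sinc {x : ℝ} (hx : x ^ 2 ≤ 1) : 2 / 3 ≤ Real.sinc x := by
  wlog x_nonneg : 0 ≤ x generalizing x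
  · rw [← Real.sinc_neg]
    exact this (by rwa [neg_sq]) (by linarith)
  rcases x_nonneg.eq_or_lt with rfl | x_pos
  · norm_num
  · rw [Real.sinc_of_ne_zero x_pos.ne', le_div_iff₀ x_pos]
    linarith [Real.sin_ge_sub_cube x_nonneg, mul_le_of_le_one_left x_nonneg hx,
      show x ^ 3 = x ^ 2 * x by ring]

lemma sinc_sq_le_inv_sq {x : ℝ} (hx : x ≠ 0) : Real.sinc x ^ 2 ≤ (x ^ 2)⁻¹ := by
  rw [Real.sinc_of_ne_zero hx, div_pow, div_eq_mul_inv]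
  exact mul_le_of_le_one_left (by positivity) (Real.sin_sq_le_one x)

variable {Δ γ σ ε t : ℝ}

/-- The regime of the parameters in which one interaction drives the resonant transitions at a rate
of order `(αt)²` and all others at a rate smaller by a factor of order `ε`. The times in
`[timeLower, timeUpper]` are those satisfying `1 ≤ Δ² ε t² (1 - σ² t² / 2)`. -/
structure IsResonant (Δ γ σ ε t : ℝ) : Prop where
  error_pos : 0 < ε
  time_pos : 0 < t
  detuning_le : |Δ - γ| ≤ σ
  width_pos : 0 < σ
  width_le : σ ≤ Δ * √(ε / 2)
  width_mul_time_lt : σ ^ 2 * t ^ 2 < 2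
  one_le_mul_time_sq : 1 ≤ Δ ^ 2 * ε * t ^ 2

lemma gap_pos_of_width_le (hσ : 0 < σ) (h : σ ≤ Δ * √(ε / 2)) : 0 < Δ :=
  pos_of_mul_pos_left (hσ.trans_le h) (Real.sqrt_nonneg _)

lemma two_mul_sq_div_mem_Ioc (hσ : 0 < σ) (hε : 0 < ε) (hle : σ ≤ Δ * √(ε / 2)) :
    2 * σ ^ 2 / (Δ ^ 2 * ε) ∈ Set.Ioc (0 : ℝ) 1 := by
  have Δ_pos := gap_pos_of_width_le hσ hle
  have width_sq : σ ^ 2 ≤ (Δ * √(ε / 2)) ^ 2 := by gcongr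
  rw [mul_pow, Real.sq_sqrt (by positivity)] at width_sq
  exact ⟨by positivity, (div_le_one (by positivity)).2 (by linarith)⟩

lemma sq_mul_timeLower_sq (hσ : 0 < σ) (hε : 0 < ε) :
    σ ^ 2 * timeLower Δ σ ε ^ 2 = 1 - √(1 - 2 * σ ^ 2 / (Δ ^ 2 * ε)) := by
  have sqrt_le_one : √(1 - 2 * σ ^ 2 / (Δ ^ 2 * ε)) ≤ 1 :=
    Real.sqrt_le_one.2 (sub_le_self _ (by positivity))
  rw [timeLower, mul_pow, Real.sq_sqrt (by linarith)]
  field_simp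

lemma sq_mul_timeUpper_sq (hσ : 0 < σ) :
    σ ^ 2 * timeUpper Δ σ ε ^ 2 = 1 + √(1 - 2 * σ ^ 2 / (Δ ^ 2 * ε)) := by
  rw [timeUpper, mul_pow, Real.sq_sqrt (by positivity)]
  field_simp

lemma timeLower_pos (hσ : 0 < σ) (hε : 0 < ε) (hle : σ ≤ Δ * √(ε / 2)) :
    0 < timeLower Δ σ ε := by
  obtain ⟨ratio_pos, -⟩ := two_mul_sq_div_mem_Ioc hσ hε hle
  have sqrt_lt_one : √(1 - 2 * σ ^ 2 / (Δ ^ 2 * ε)) < 1 := by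
    rw [Real.sqrt_lt' one_pos]
    linarith
  have := Real.sqrt_pos.2 (sub_pos.2 sqrt_lt_one)
  rw [timeLower]
  positivity

lemma isResonant_of_mem_window (hε : 0 < ε) (hσ : 0 < σ) (hγ : |Δ - γ| ≤ σ)
    (hle : σ ≤ Δ * √(ε / 2)) (ht : t ∈ Set.Icc (timeLower Δ σ ε) (timeUpper Δ σ ε)) :
    IsResonant Δ γ σ ε t := by
  have Δ_pos := gap_pos_of_width_le hσ hle
  have lower_pos := timeLower_pos hσ hε hle
  have t_pos := lower_pos.trans_le ht.1
  obtain ⟨ratio_pos, ratio_le_one⟩ := two_mul_sq_div_mem_Ioc hσ hε hle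
  have lower : σ ^ 2 * timeLower Δ σ ε ^ 2 ≤ σ ^ 2 * t ^ 2 := by gcongr; exact ht.1
  have upper : σ ^ 2 * t ^ 2 ≤ σ ^ 2 * timeUpper Δ σ ε ^ 2 := by gcongr; exact ht.2
  rw [sq_mul_timeLower_sq hσ hε] at lower
  rw [sq_mul_timeUpper_sq hσ] at upper
  set w := 2 * σ ^ 2 / (Δ ^ 2 * ε) with w_def
  have sqrt_sq : √(1 - w) ^ 2 = 1 - w := Real.sq_sqrt (by linarith)
  have sqrt_lt_one : √(1 - w) < 1 := by
    rw [Real.sqrt_lt' one_pos]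
    linarith
  have quadratic : w ≤ 2 * (σ ^ 2 * t ^ 2) - (σ ^ 2 * t ^ 2) ^ 2 := by
    nlinarith
  refine ⟨hε, t_pos, hγ, hσ, hle, by linarith, ?_⟩
  have w_le : w ≤ 2 * (σ ^ 2 * t ^ 2) := quadratic.trans (sub_le_self _ (sq_nonneg _))
  rw [w_def, div_le_iff₀ (by positivity)] at w_le
  refine le_of_mul_le_mul_left ?_ (by positivity : 0 < 2 * σ ^ 2)
  linarith

lemma timeLower_le_timeUpper (hσ : 0 < σ) : timeLower Δ σ ε ≤ timeUpper Δ σ ε := by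
  rw [timeLower, timeUpper]
  gcongr
  linarith [Real.sqrt_nonneg (1 - 2 * σ ^ 2 / (Δ ^ 2 * ε))]

lemma timeLower_sq_le (hσ : 0 < σ) (hε : 0 < ε) (hle : σ ≤ Δ * √(ε / 2)) :
    timeLower Δ σ ε ^ 2 ≤ 2 / (Δ ^ 2 * ε) := by
  have := gap_pos_of_width_le hσ hle
  obtain ⟨ratio_pos, ratio_le_one⟩ := two_mul_sq_div_mem_Ioc hσ hε hle
  have le_sqrt : 1 - 2 * σ ^ 2 / (Δ ^ 2 * ε) ≤ √(1 - 2 * σ ^ 2 / (Δ ^ 2 * ε)) := by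
    rw [Real.le_sqrt (by linarith) (by linarith)]
    exact pow_le_of_le_one (by linarith) (by linarith) two_ne_zero
  refine le_of_mul_le_mul_left ?_ (by positivity : 0 < σ ^ 2)
  calc σ ^ 2 * timeLower Δ σ ε ^ 2 ≤ 2 * σ ^ 2 / (Δ ^ 2 * ε) := by
        rw [sq_mul_timeLower_sq hσ hε]
        linarith
    _ = σ ^ 2 * (2 / (Δ ^ 2 * ε)) := by ring

end Window

/-! ### Transition rates on and off resonance -/

section Rates

variable {n : Type*} [Fintype n] [DecidableEq n]

lemma transitionMatrix_le_of_sinc_sq_le (E : n → ℝ) {α t : ℝ} (ht : 0 ≤ t) {a b : n}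
    (hab : a ≠ b) {c δ : ℝ} (hc : Real.sinc ((E a - E b) * t / 2) ^ 2 ≤ c)
    (hδ : (α * t) ^ 2 ≤ δ) :
    transitionMatrix E α t a b
      ≤ (α * t) ^ 2 * (2 * c / (Fintype.card n + 1) + 2 * δ * fourthMoment n) := by
  have := fourthMoment_nonneg n
  calc transitionMatrix E α t a b
      ≤ 2 * (α * t * Real.sinc ((E a - E b) * t / 2)) ^ 2 / (Fintype.card n + 1)
        + 2 * (α * t) ^ 4 * fourthMoment n := transitionMatrix_le E α ht hab
    _ = (α * t) ^ 2 * (2 * Real.sinc ((E a - E b) * t / 2) ^ 2 / (Fintype.card n + 1)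
        + 2 * (α * t) ^ 2 * fourthMoment n) := by ring
    _ ≤ _ := by gcongr

lemma le_transitionMatrix_of_le_sinc_sq (E : n → ℝ) {α t : ℝ} (ht : 0 ≤ t) {a b : n}
    (hab : a ≠ b) {c δ : ℝ} (hc : c ≤ Real.sinc ((E a - E b) * t / 2) ^ 2)
    (hδ : (α * t) ^ 2 ≤ δ) :
    (α * t) ^ 2 * (c / (2 * (Fintype.card n + 1)) - δ * fourthMoment n)
      ≤ transitionMatrix E α t a b := by
  have := fourthMoment_nonneg n
  calc (α * t) ^ 2 * (c / (2 * (Fintype.card n + 1)) - δ * fourthMoment n)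
      ≤ (α * t) ^ 2 * (Real.sinc ((E a - E b) * t / 2) ^ 2 / (2 * (Fintype.card n + 1))
        - (α * t) ^ 2 * fourthMoment n) := by gcongr
    _ = (α * t * Real.sinc ((E a - E b) * t / 2)) ^ 2 / (Fintype.card n + 1) / 2
        - (α * t) ^ 4 * fourthMoment n := by
      rw [div_div, mul_comm _ (2 : ℝ)]
      ring
    _ ≤ _ := le_transitionMatrix E α ht hab

lemma half_gap_le_abs_uncoupledLevels_sub {e h : Fin 2 → ℝ} (he : 0 ≤ e 1 - e 0)
    (hh : (e 1 - e 0) / 2 ≤ h 1 - h 0) {a b : Fin 2 × Fin 2} (hab : b ≠ a)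
    (hswap : b ≠ a.swap) :
    (e 1 - e 0) / 2 ≤ |uncoupledLevels e h a - uncoupledLevels e h b| := by
  obtain ⟨i, k⟩ := a
  obtain ⟨j, l⟩ := b
  rw [le_abs]
  simp only [uncoupledLevels]
  fin_cases i <;> fin_cases k <;> fin_cases j <;> fin_cases l <;>
    simp only [Fin.zero_eta, Fin.mk_one] <;>
    first
    | exact absurd rfl hab
    | exact absurd rfl hswap
    | left; linarith
    | right; linarith

lemma coupling_mul_self {Δ σ t : ℝ} (ht : t ≠ 0) :
    coupling Δ σ t * t = 1 / (t ^ 2 * (Δ + σ) ^ 2) := by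
  rw [coupling]
  field_simp

namespace IsResonant

variable {Δ γ σ ε t : ℝ}

lemma gap_pos (h : IsResonant Δ γ σ ε t) : 0 < Δ :=
  gap_pos_of_width_le h.width_pos h.width_le

lemma coupling_mul_pos (h : IsResonant Δ γ σ ε t) : 0 < coupling Δ σ t * t := by
  have := h.gap_pos
  have := h.width_pos
  have := h.time_pos
  rw [coupling]
  positivity

lemma coupling_mul_le (h : IsResonant Δ γ σ ε t) : coupling Δ σ t * t ≤ ε := by
  have := h.gap_pos
  have := h.width_pos
  have := h.time_pos
  have := h.error_pos
  rw [coupling_mul_self h.time_pos.ne', div_le_iff₀ (by positivity)]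
  calc (1 : ℝ) ≤ Δ ^ 2 * ε * t ^ 2 := h.one_le_mul_time_sq
    _ ≤ (Δ + σ) ^ 2 * ε * t ^ 2 := by
      gcongr
      linarith
    _ = ε * (t ^ 2 * (Δ + σ) ^ 2) := by ring

lemma coupling_mul_sq_le (h : IsResonant Δ γ σ ε t) (hε : ε ≤ 1) :
    (coupling Δ σ t * t) ^ 2 ≤ ε :=
  (pow_le_of_le_one h.coupling_mul_pos.le (h.coupling_mul_le.trans hε) two_ne_zero).trans
    h.coupling_mul_le

lemma two_thirds_le_sinc_detuning (h : IsResonant Δ γ σ ε t) :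
    2 / 3 ≤ Real.sinc ((Δ - γ) * t / 2) := by
  refine two_thirds_le_sinc ?_
  have detuning_sq_le : (Δ - γ) ^ 2 ≤ σ ^ 2 := sq_le_sq.2 (h.detuning_le.trans (le_abs_self σ))
  calc ((Δ - γ) * t / 2) ^ 2 = (Δ - γ) ^ 2 * t ^ 2 / 4 := by ring
    _ ≤ σ ^ 2 * t ^ 2 / 4 := by gcongr
    _ ≤ 1 := by linarith [h.width_mul_time_lt]

lemma half_gap_le (h : IsResonant Δ γ σ ε t) (hε : ε ≤ 1 / 2) : Δ / 2 ≤ γ := by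
  have := h.gap_pos
  have sqrt_le : √(ε / 2) ≤ 1 / 2 := Real.sqrt_le_iff.2 ⟨by norm_num, by linarith⟩
  have width_le : σ ≤ Δ * (1 / 2) := h.width_le.trans (by gcongr)
  linarith [(abs_le.1 h.detuning_le).2]

lemma sinc_sq_le_of_half_gap_le_abs (h : IsResonant Δ γ σ ε t) {ω : ℝ} (hω : Δ / 2 ≤ |ω|) :
    Real.sinc (ω * t / 2) ^ 2 ≤ 16 * ε := by
  have Δ_pos := h.gap_pos
  have t_pos := h.time_pos
  have ω_ne_zero : ω ≠ 0 := abs_pos.1 ((half_pos Δ_pos).trans_le hω)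
  have ω_sq : (Δ / 2) ^ 2 ≤ ω ^ 2 := sq_le_sq.2 (by rwa [abs_of_pos (half_pos Δ_pos)])
  refine (sinc_sq_le_inv_sq (by positivity)).trans ?_
  rw [inv_le_iff_one_le_mul₀ (by positivity)]
  have := h.error_pos
  calc (1 : ℝ) ≤ Δ ^ 2 * ε * t ^ 2 := h.one_le_mul_time_sq
    _ = 16 * ε * ((Δ / 2) ^ 2 * t ^ 2 / 4) := by ring
    _ ≤ 16 * ε * (ω ^ 2 * t ^ 2 / 4) := by gcongr
    _ = 16 * ε * (ω * t / 2) ^ 2 := by ring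

variable {e : Fin 2 → ℝ}

lemma transitionMatrix_off_resonance_le (h : IsResonant Δ γ σ ε t) (he : e 1 - e 0 = Δ)
    (hε : ε ≤ 1 / 2) {a b : Fin 2 × Fin 2} (hab : b ≠ a) (hswap : b ≠ a.swap) :
    transitionMatrix (uncoupledLevels e ![0, γ]) (coupling Δ σ t) t a b
      ≤ (coupling Δ σ t * t) ^ 2 * ((7 + 2 * fourthMoment (Fin 2 × Fin 2)) * ε) := by
  subst he
  have gap_le := half_gap_le_abs_uncoupledLevels_sub (h := ![0, γ]) h.gap_pos.le
    (by simpa using h.half_gap_le hε) hab hswap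
  refine (transitionMatrix_le_of_sinc_sq_le _ h.time_pos.le hab.symm
    (h.sinc_sq_le_of_half_gap_le_abs gap_le) (h.coupling_mul_sq_le (by linarith))).trans ?_
  rw [Fintype.card_prod, Fintype.card_fin]
  gcongr
  push_cast
  linarith [h.error_pos]

lemma le_transitionMatrix_resonance (h : IsResonant Δ γ σ ε t) (he : e 1 - e 0 = Δ)
    (hε : ε ≤ 1) :
    (coupling Δ σ t * t) ^ 2 * (2 / 45 - fourthMoment (Fin 2 × Fin 2) * ε)
      ≤ transitionMatrix (uncoupledLevels e ![0, γ]) (coupling Δ σ t) t (1, 0) (0, 1) := by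
  have detuning_eq : uncoupledLevels e ![0, γ] (1, 0) - uncoupledLevels e ![0, γ] (0, 1)
      = Δ - γ := by
    simp only [uncoupledLevels, Matrix.cons_val_zero, Matrix.cons_val_one, ← he]
    ring
  have sinc_sq : (2 / 3) ^ 2 ≤ Real.sinc ((uncoupledLevels e ![0, γ] (1, 0)
      - uncoupledLevels e ![0, γ] (0, 1)) * t / 2) ^ 2 := by
    rw [detuning_eq]
    gcongr
    exact h.two_thirds_le_sinc_detuning
  refine Eq.trans_le ?_ (le_transitionMatrix_of_le_sinc_sq _ h.time_pos.le (by decide)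
    sinc_sq (h.coupling_mul_sq_le hε))
  rw [Fintype.card_prod, Fintype.card_fin]
  push_cast
  ring

lemma transitionMatrix_le_of_ne (h : IsResonant Δ γ σ ε t) (hε : ε ≤ 1) (E : Fin 2 × Fin 2 → ℝ)
    {a b : Fin 2 × Fin 2} (hab : a ≠ b) :
    transitionMatrix E (coupling Δ σ t) t a b
      ≤ (coupling Δ σ t * t) ^ 2 * (1 + 2 * fourthMoment (Fin 2 × Fin 2)) := by
  have sinc_sq : Real.sinc ((E a - E b) * t / 2) ^ 2 ≤ 1 :=
    (sq_le_one_iff_abs_le_one _).2 (Real.abs_sinc_le_one _)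
  refine (transitionMatrix_le_of_sinc_sq_le E h.time_pos.le hab sinc_sq
    ((h.coupling_mul_sq_le hε).trans hε)).trans ?_
  rw [Fintype.card_prod, Fintype.card_fin]
  have := fourthMoment_nonneg (Fin 2 × Fin 2)
  gcongr <;> norm_num

end IsResonant

end Rates

/-! ### The number of interactions -/

section NumInteractions

variable {Δ γ σ ε t : ℝ}

/-- The logarithmic factor in the number of interactions. -/
def logFactor (Δ γ σ ε t : ℝ) : ℝ :=
  2 * Real.log (5 / ((coupling Δ σ t * t) ^ 2 * Real.sinc (|Δ - γ| * t / 2) ^ 2))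
    + 4 * (1 + Real.log 2) - 1 / 2 + Real.log (2 / ε)

lemma numInteractions_eq : numInteractions Δ γ σ ε t =
    ⌈10 / ((coupling Δ σ t * t) ^ 2 * (1 - σ ^ 2 * t ^ 2 / 2)) * logFactor Δ γ σ ε t⌉₊ := by
  rw [numInteractions, logFactor, mul_pow]

lemma log_one_div_le_abs_log (ε : ℝ) : Real.log (1 / ε) ≤ |Real.log ε| := by
  rw [one_div, Real.log_inv]
  exact neg_le_abs _

lemma log_two_div_le (hε : 0 < ε) : Real.log (2 / ε) ≤ 1 + |Real.log ε| := by
  rw [Real.log_div two_ne_zero hε.ne']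
  linarith [Real.log_two_lt_d9, neg_le_abs (Real.log ε)]

namespace IsResonant

lemma two_thirds_le_sinc_abs_detuning (h : IsResonant Δ γ σ ε t) :
    2 / 3 ≤ Real.sinc (|Δ - γ| * t / 2) := by
  rcases abs_cases (Δ - γ) with ⟨abs_eq, -⟩ | ⟨abs_eq, -⟩
  · rw [abs_eq]
    exact h.two_thirds_le_sinc_detuning
  · rw [abs_eq, neg_mul, neg_div, Real.sinc_neg]
    exact h.two_thirds_le_sinc_detuning

lemma five_mul_log_le_logFactor (h : IsResonant Δ γ σ ε t) :
    5 * Real.log (1 / ε) ≤ logFactor Δ γ σ ε t := by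
  have ε_pos := h.error_pos
  have coupling_pos := h.coupling_mul_pos
  have sinc_pos : 0 < Real.sinc (|Δ - γ| * t / 2) :=
    lt_of_lt_of_le (by norm_num) h.two_thirds_le_sinc_abs_detuning
  have log_le_log_div : 2 * Real.log (1 / ε)
      ≤ Real.log (5 / ((coupling Δ σ t * t) ^ 2 * Real.sinc (|Δ - γ| * t / 2) ^ 2)) := by
    rw [← Nat.cast_two, ← Real.log_pow, div_pow, one_pow]
    gcongr
    · norm_num
    · calc (coupling Δ σ t * t) ^ 2 * Real.sinc (|Δ - γ| * t / 2) ^ 2 ≤ ε ^ 2 * 1 ^ 2 := by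
            gcongr
            · exact h.coupling_mul_le
            · exact Real.sinc_le_one _
        _ = ε ^ 2 := by ring
  have log_le_log_two_div : Real.log (1 / ε) ≤ Real.log (2 / ε) := by
    gcongr
    norm_num
  rw [logFactor]
  linarith [Real.log_two_gt_d9]

lemma log_le_mul_numInteractions (h : IsResonant Δ γ σ ε t) (hε : ε ≤ 1) :
    Real.log (1 / ε) ≤ (coupling Δ σ t * t) ^ 2 / 50 * numInteractions Δ γ σ ε t := by
  have coupling_pos := h.coupling_mul_pos
  have log_nonneg : 0 ≤ Real.log (1 / ε) := Real.log_nonneg (one_le_one_div h.error_pos hε)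
  have := sub_pos.2 ((div_lt_one two_pos).2 h.width_mul_time_lt)
  calc Real.log (1 / ε)
      = (coupling Δ σ t * t) ^ 2 / 50
        * (10 / (coupling Δ σ t * t) ^ 2 * (5 * Real.log (1 / ε))) := by
        generalize coupling Δ σ t * t = x at coupling_pos
        field_simp
        ring
    _ ≤ (coupling Δ σ t * t) ^ 2 / 50 * (10 / ((coupling Δ σ t * t) ^ 2
        * (1 - σ ^ 2 * t ^ 2 / 2)) * logFactor Δ γ σ ε t) := by
      gcongr
      · exact mul_le_of_le_one_right (by positivity) (sub_le_self _ (by positivity))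
      · exact h.five_mul_log_le_logFactor
    _ ≤ (coupling Δ σ t * t) ^ 2 / 50 * numInteractions Δ γ σ ε t := by
      rw [numInteractions_eq]
      gcongr
      exact Nat.le_ceil _

lemma pow_numInteractions_le (h : IsResonant Δ γ σ ε t) (hε : ε ≤ 1) :
    (1 - (coupling Δ σ t * t) ^ 2 / 50) ^ numInteractions Δ γ σ ε t ≤ ε := by
  have rate_le_one : (coupling Δ σ t * t) ^ 2 / 50 ≤ 1 := by
    linarith [h.coupling_mul_sq_le hε]
  calc (1 - (coupling Δ σ t * t) ^ 2 / 50) ^ numInteractions Δ γ σ ε t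
      ≤ Real.exp (-((coupling Δ σ t * t) ^ 2 / 50)) ^ numInteractions Δ γ σ ε t :=
        pow_le_pow_left₀ (sub_nonneg.2 rate_le_one) (Real.one_sub_le_exp_neg _) _
    _ = Real.exp (-((coupling Δ σ t * t) ^ 2 / 50 * numInteractions Δ γ σ ε t)) := by
      rw [← Real.exp_nat_mul, mul_neg, mul_comm]
    _ ≤ Real.exp (-Real.log (1 / ε)) := by
      gcongr
      exact h.log_le_mul_numInteractions hε
    _ = ε := by rw [one_div, Real.log_inv, neg_neg, Real.exp_log h.error_pos]

lemma logFactor_le (h : IsResonant Δ γ σ ε t)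
    (hα : 1 / (coupling Δ σ t * t) ^ 2 ≤ 64 / ε ^ 2) :
    logFactor Δ γ σ ε t ≤ 2000 * (1 + |Real.log ε|) := by
  have ε_pos := h.error_pos
  have coupling_pos := h.coupling_mul_pos
  have sinc_ge := h.two_thirds_le_sinc_abs_detuning
  have : 0 < Real.sinc (|Δ - γ| * t / 2) := by linarith
  have ratio_le : 5 / ((coupling Δ σ t * t) ^ 2 * Real.sinc (|Δ - γ| * t / 2) ^ 2)
      ≤ 720 * (1 / ε) ^ 2 := by
    calc 5 / ((coupling Δ σ t * t) ^ 2 * Real.sinc (|Δ - γ| * t / 2) ^ 2)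
        ≤ 5 / ((coupling Δ σ t * t) ^ 2 * (2 / 3) ^ 2) := by gcongr
      _ = 45 / 4 * (1 / (coupling Δ σ t * t) ^ 2) := by
        field_simp
        norm_num
      _ ≤ 45 / 4 * (64 / ε ^ 2) := by gcongr
      _ = 720 * (1 / ε) ^ 2 := by ring
  have log_ratio_le : Real.log (5 / ((coupling Δ σ t * t) ^ 2
      * Real.sinc (|Δ - γ| * t / 2) ^ 2)) ≤ 720 + 2 * |Real.log ε| := by
    calc _ ≤ Real.log (720 * (1 / ε) ^ 2) := by gcongr
      _ = Real.log 720 + 2 * Real.log (1 / ε) := by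
        rw [Real.log_mul (by norm_num) (by positivity), Real.log_pow, Nat.cast_two]
      _ ≤ 720 + 2 * |Real.log ε| := by
        gcongr
        · exact Real.log_le_self (by norm_num)
        · exact log_one_div_le_abs_log ε
  rw [logFactor]
  linarith [log_two_div_le ε_pos, Real.log_two_lt_d9, abs_nonneg (Real.log ε)]

end IsResonant

/-! ### The total simulation time -/

lemma one_div_coupling_mul_timeLower_sq_le (hσ : 0 < σ) (hε : 0 < ε) (hε2 : ε ≤ 2)
    (hle : σ ≤ Δ * √(ε / 2)) :
    1 / (coupling Δ σ (timeLower Δ σ ε) * timeLower Δ σ ε) ^ 2 ≤ 64 / ε ^ 2 := by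
  have Δ_pos := gap_pos_of_width_le hσ hle
  have width_le : σ ≤ Δ :=
    hle.trans (mul_le_of_le_one_right Δ_pos.le (Real.sqrt_le_one.2 (by linarith)))
  have time_le := timeLower_sq_le hσ hε hle
  rw [coupling_mul_self (timeLower_pos hσ hε hle).ne', div_pow, one_pow, one_div_one_div]
  calc (timeLower Δ σ ε ^ 2 * (Δ + σ) ^ 2) ^ 2
      ≤ (2 / (Δ ^ 2 * ε) * (Δ + Δ) ^ 2) ^ 2 := by gcongr
    _ = 64 / ε ^ 2 := by
      field_simp
      norm_num

lemma timeLower_le (hσ : 0 < σ) (hε : 0 < ε) (hle : σ ≤ Δ * √(ε / 2)) :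
    timeLower Δ σ ε ≤ 2 / (Δ * √ε) := by
  have := gap_pos_of_width_le hσ hle
  refine le_of_sq_le_sq ?_ (by positivity)
  calc timeLower Δ σ ε ^ 2 ≤ 2 / (Δ ^ 2 * ε) := timeLower_sq_le hσ hε hle
    _ ≤ 2 ^ 2 / (Δ ^ 2 * ε) := by
      gcongr
      norm_num
    _ = (2 / (Δ * √ε)) ^ 2 := by rw [div_pow, mul_pow, Real.sq_sqrt hε.le]

lemma numInteractions_timeLower_le (hε : 0 < ε) (hε2 : ε ≤ 2) (hσ : 0 < σ)
    (hle : σ ≤ Δ * √(ε / 2)) (hγ : |Δ - γ| ≤ σ) :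
    (numInteractions Δ γ σ ε (timeLower Δ σ ε) : ℝ)
      ≤ 5000000 * (1 + |Real.log ε|) / ε ^ 2 := by
  have resonant : IsResonant Δ γ σ ε (timeLower Δ σ ε) :=
    isResonant_of_mem_window hε hσ hγ hle ⟨le_rfl, timeLower_le_timeUpper hσ⟩
  have coupling_pos := resonant.coupling_mul_pos
  have coupling_inv_le := one_div_coupling_mul_timeLower_sq_le hσ hε hε2 hle
  have window_factor : 1 / 2 ≤ 1 - σ ^ 2 * timeLower Δ σ ε ^ 2 / 2 := by
    rw [sq_mul_timeLower_sq hσ hε]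
    linarith [Real.sqrt_nonneg (1 - 2 * σ ^ 2 / (Δ ^ 2 * ε))]
  have prefactor_le : 10 / ((coupling Δ σ (timeLower Δ σ ε) * timeLower Δ σ ε) ^ 2
      * (1 - σ ^ 2 * timeLower Δ σ ε ^ 2 / 2)) ≤ 1280 / ε ^ 2 := by
    calc _ ≤ 10 / ((coupling Δ σ (timeLower Δ σ ε) * timeLower Δ σ ε) ^ 2 * (1 / 2)) := by
          gcongr
      _ = 20 * (1 / (coupling Δ σ (timeLower Δ σ ε) * timeLower Δ σ ε) ^ 2) := by
        field_simp
        norm_num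
      _ ≤ 20 * (64 / ε ^ 2) := by gcongr
      _ = 1280 / ε ^ 2 := by ring
  have prefactor_nonneg : 0 ≤ 10 / ((coupling Δ σ (timeLower Δ σ ε) * timeLower Δ σ ε) ^ 2
      * (1 - σ ^ 2 * timeLower Δ σ ε ^ 2 / 2)) :=
    div_nonneg (by norm_num) (mul_nonneg (sq_nonneg _) (by linarith))
  calc (numInteractions Δ γ σ ε (timeLower Δ σ ε) : ℝ)
      ≤ ⌈1280 / ε ^ 2 * (2000 * (1 + |Real.log ε|))⌉₊ := by
        rw [numInteractions_eq]
        refine Nat.cast_le.2 (Nat.ceil_mono ?_)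
        exact (mul_le_mul_of_nonneg_left (resonant.logFactor_le coupling_inv_le)
          prefactor_nonneg).trans (mul_le_mul_of_nonneg_right prefactor_le (by positivity))
    _ ≤ 1280 / ε ^ 2 * (2000 * (1 + |Real.log ε|)) + 2 ^ 2 / ε ^ 2 := by
      refine (Nat.ceil_lt_add_one (by positivity)).le.trans ?_
      gcongr
      rw [one_le_div (by positivity)]
      gcongr
    _ = (2560000 * (1 + |Real.log ε|) + 4) / ε ^ 2 := by ring
    _ ≤ 5000000 * (1 + |Real.log ε|) / ε ^ 2 := by
      gcongr
      linarith [abs_nonneg (Real.log ε)]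

lemma numInteractions_mul_timeLower_le (hε : 0 < ε) (hε2 : ε ≤ 2) (hσ : 0 < σ)
    (hle : σ ≤ Δ * √(ε / 2)) (hγ : |Δ - γ| ≤ σ) :
    numInteractions Δ γ σ ε (timeLower Δ σ ε) * timeLower Δ σ ε
      ≤ 10000000 * (1 + |Real.log ε|) / (Δ * ε ^ (2.5 : ℝ)) := by
  have rpow_eq : ε ^ (2.5 : ℝ) = ε ^ 2 * √ε := by
    rw [Real.sqrt_eq_rpow, ← Real.rpow_natCast, ← Real.rpow_add hε]
    norm_num
  calc numInteractions Δ γ σ ε (timeLower Δ σ ε) * timeLower Δ σ ε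
      ≤ 5000000 * (1 + |Real.log ε|) / ε ^ 2 * (2 / (Δ * √ε)) :=
        mul_le_mul (numInteractions_timeLower_le hε hε2 hσ hle hγ) (timeLower_le hσ hε hle)
          (timeLower_pos hσ hε hle).le (by positivity)
    _ = 10000000 * (1 + |Real.log ε|) / (Δ * ε ^ (2.5 : ℝ)) := by
      rw [rpow_eq]
      ring

end NumInteractions

/-! ### Thermalization of a qubit -/

section Thermalization

variable {Δ γ σ ε t : ℝ}

/-- A scale of `ε` below which the perturbative bounds on the resonant transition probability
dominate all error terms. -/
def smallScale : ℝ := 1 / (100 * (14 + 5 * fourthMoment (Fin 2 × Fin 2)))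

lemma smallScale_pos : 0 < smallScale := by
  have := fourthMoment_nonneg (Fin 2 × Fin 2)
  rw [smallScale]
  positivity

lemma mul_le_one_of_le_smallScale (hε : ε ≤ smallScale) :
    ε * (100 * (14 + 5 * fourthMoment (Fin 2 × Fin 2))) ≤ 1 := by
  have := fourthMoment_nonneg (Fin 2 × Fin 2)
  rwa [smallScale, le_div_iff₀ (by positivity)] at hε

lemma smallScale_le : smallScale ≤ 1 / 1400 := by
  have := fourthMoment_nonneg (Fin 2 × Fin 2)
  rw [smallScale]
  gcongr
  linarith

namespace IsResonant

variable {e : Fin 2 → ℝ}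

lemma decay_le_qubitChain_add (h : IsResonant Δ γ σ ε t) (he : e 1 - e 0 = Δ)
    (hε : ε ≤ smallScale) (β : ℝ) :
    (coupling Δ σ t * t) ^ 2 / 50
      ≤ qubitChain e γ (coupling Δ σ t) β t 1 0 + qubitChain e γ (coupling Δ σ t) β t 0 1 := by
  have ε_le := hε.trans smallScale_le
  have resonance := h.le_transitionMatrix_resonance he (by linarith)
  refine le_trans ?_ (sub_le_reducedMatrix_add (transitionMatrix_mem_doublyStochastic _ _ t)
    (fun _ _ => h.transitionMatrix_off_resonance_le he (by linarith))
    (boltzmann_mem_stdSimplex _ β))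
  set K := fourthMoment (Fin 2 × Fin 2)
  calc (coupling Δ σ t * t) ^ 2 / 50 = (coupling Δ σ t * t) ^ 2 * (1 / 50) := by ring
    _ ≤ (coupling Δ σ t * t) ^ 2 * (2 / 45 - K * ε - 2 * ((7 + 2 * K) * ε)) := by
      gcongr
      linarith [mul_le_one_of_le_smallScale hε]
    _ ≤ _ := by linarith

lemma qubitChain_add_le_one (h : IsResonant Δ γ σ ε t) (he : e 1 - e 0 = Δ)
    (hε : ε ≤ smallScale) (β : ℝ) :
    qubitChain e γ (coupling Δ σ t) β t 1 0 + qubitChain e γ (coupling Δ σ t) β t 0 1 ≤ 1 := by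
  have ε_pos := h.error_pos
  have ε_le := hε.trans smallScale_le
  have K_nonneg := fourthMoment_nonneg (Fin 2 × Fin 2)
  have excitation := h.transitionMatrix_le_of_ne (by linarith) (uncoupledLevels e ![0, γ])
    (show ((1, 0) : Fin 2 × Fin 2) ≠ (0, 1) by decide)
  have relaxation := h.transitionMatrix_le_of_ne (by linarith) (uncoupledLevels e ![0, γ])
    (show ((0, 1) : Fin 2 × Fin 2) ≠ (1, 0) by decide)
  refine (reducedMatrix_add_le
    (fun _ _ => nonneg_of_mem_doublyStochastic (transitionMatrix_mem_doublyStochastic _ _ t))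
    (fun _ _ => h.transitionMatrix_off_resonance_le he (by linarith))
    (boltzmann_mem_stdSimplex _ β)).trans ?_
  set K := fourthMoment (Fin 2 × Fin 2)
  calc _ ≤ (coupling Δ σ t * t) ^ 2 * (2 * (1 + 2 * K) + 4 * ((7 + 2 * K) * ε)) := by linarith
    _ ≤ ε * (2 * (1 + 2 * K) + 4 * ((7 + 2 * K) * 1)) := by
      gcongr
      · exact h.coupling_mul_sq_le (by linarith)
      · linarith
    _ ≤ 1 := by linarith [mul_le_one_of_le_smallScale hε, mul_nonneg ε_pos.le K_nonneg]

lemma abs_qubitChain_detailed_balance_le (h : IsResonant Δ γ σ ε t) (he : e 1 - e 0 = Δ)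
    (hε : ε ≤ 1 / 2) (β : ℝ) :
    |qubitChain e γ (coupling Δ σ t) β t 1 0 * boltzmann ![0, γ] β 0
        - qubitChain e γ (coupling Δ σ t) β t 0 1 * boltzmann ![0, γ] β 1|
      ≤ 4 * ((coupling Δ σ t * t) ^ 2 * ((7 + 2 * fourthMoment (Fin 2 × Fin 2)) * ε)) :=
  abs_reducedMatrix_detailed_balance_le (transitionMatrix_mem_doublyStochastic _ _ t)
    (fun _ _ => h.transitionMatrix_off_resonance_le he hε) (boltzmann_mem_stdSimplex _ β)

lemma abs_qubitChain_pow_mulVec_sub_boltzmann_le (h : IsResonant Δ γ σ ε t)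
    (he : e 1 - e 0 = Δ) (hε : ε ≤ smallScale) (β : ℝ) {p : Fin 2 → ℝ}
    (hp : p ∈ stdSimplex ℝ (Fin 2)) :
    |(qubitChain e γ (coupling Δ σ t) β t ^ numInteractions Δ γ σ ε t *ᵥ p) 1
        - boltzmann ![0, γ] β 1|
      ≤ (1 + 200 * (7 + 2 * fourthMoment (Fin 2 × Fin 2))) * ε := by
  have ε_le := hε.trans smallScale_le
  have coupling_pos := h.coupling_mul_pos
  have decay_le_one := (h.decay_le_qubitChain_add he hε β).trans (h.qubitChain_add_le_one he hε β)
  have boltzmann_mem := boltzmann_mem_stdSimplex ![0, γ] β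
  have distance_le_one : |p 1 - boltzmann ![0, γ] β 1| ≤ 1 :=
    Real.dist_le_of_mem_Icc_01 (mem_Icc_of_mem_stdSimplex hp 1)
      (mem_Icc_of_mem_stdSimplex boltzmann_mem 1)
  refine (abs_pow_mulVec_sub_le_of_detailed_balance (qubitChain_mem_colStochastic e γ _ β t) hp
    boltzmann_mem (by positivity) (h.decay_le_qubitChain_add he hε β)
    (h.qubitChain_add_le_one he hε β)
    (h.abs_qubitChain_detailed_balance_le he (by linarith) β) _).trans ?_
  rw [add_mul 1, one_mul]
  gcongr
  · exact (mul_le_of_le_one_right (pow_nonneg (sub_nonneg.2 decay_le_one) _)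
      distance_le_one).trans (h.pow_numInteractions_le (by linarith))
  · rw [div_le_iff₀ (by positivity)]
    linarith

end IsResonant

/-- The constant of the thermalization bound: its first summand serves `ε ≤ smallScale`, its second
makes the trivial bound `2` on the trace distance sufficient for `ε ≥ smallScale`. -/
def errorConstant : ℝ :=
  2 * (2 + 200 * (7 + 2 * fourthMoment (Fin 2 × Fin 2))) + 2 / smallScale

lemma le_errorConstant :
    2 * (2 + 200 * (7 + 2 * fourthMoment (Fin 2 × Fin 2))) ≤ errorConstant :=
  le_add_of_nonneg_right (div_pos two_pos smallScale_pos).le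

lemma two_div_smallScale_le_errorConstant : 2 / smallScale ≤ errorConstant := by
  have := fourthMoment_nonneg (Fin 2 × Fin 2)
  exact le_add_of_nonneg_left (by positivity)

lemma errorConstant_pos : 0 < errorConstant :=
  (div_pos two_pos smallScale_pos).trans_le two_div_smallScale_le_errorConstant

lemma abs_boltzmann_env_sub_boltzmann_le {e : Fin 2 → ℝ} {β : ℝ} (hβ : 0 ≤ β)
    (hγ : |e 1 - e 0 - γ| ≤ σ) :
    |boltzmann ![0, γ] β 1 - boltzmann e β 1| ≤ β * σ := by
  rw [abs_sub_comm]
  refine (abs_boltzmann_one_sub_le e ![0, γ] hβ).trans ?_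
  gcongr
  simpa using hγ

lemma traceNorm_gibbs_sub_iterate_channel_le {HS ρ : Matrix (Fin 2) (Fin 2) ℂ}
    (hHS : HS.IsHermitian) {β : ℝ} (hρ : IsDensityMatrix ρ) (hc : Commute ρ HS) (hβ : 0 ≤ β)
    (hβσ : 2 * β * σ ≤ ε) (h : IsResonant (qubitGap hHS) γ σ ε t) :
    traceNorm (gibbs HS β - (channel HS (envHamiltonian γ) (coupling (qubitGap hHS) σ t) β
        t)^[numInteractions (qubitGap hHS) γ σ ε t] ρ) ≤ errorConstant * ε := by
  have ε_pos := h.error_pos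
  obtain ⟨e, he, p, hp, trace_eq⟩ := exists_traceNorm_gibbs_sub_iterate_channel hHS h.gap_pos hρ hc
    γ (coupling (qubitGap hHS) σ t) β t (numInteractions (qubitGap hHS) γ σ ε t)
  rw [trace_eq]
  rcases le_total ε smallScale with small | large
  · have relaxation := h.abs_qubitChain_pow_mulVec_sub_boltzmann_le he small β hp
    have detuning := abs_boltzmann_env_sub_boltzmann_le hβ (he ▸ h.detuning_le)
    calc _ ≤ 2 * ((1 + 200 * (7 + 2 * fourthMoment (Fin 2 × Fin 2))) * ε + β * σ) := by
          gcongr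
          exact (abs_sub_le _ _ _).trans (add_le_add relaxation detuning)
      _ ≤ 2 * (2 + 200 * (7 + 2 * fourthMoment (Fin 2 × Fin 2))) * ε := by linarith
      _ ≤ errorConstant * ε := by
        gcongr
        exact le_errorConstant
  · have final_mem := mulVec_mem_stdSimplex
      (pow_mem (qubitChain_mem_colStochastic e γ (coupling (qubitGap hHS) σ t) β t)
        (numInteractions (qubitGap hHS) γ σ ε t)) hp
    have trivial_bound := Real.dist_le_of_mem_Icc_01 (mem_Icc_of_mem_stdSimplex final_mem 1)
      (mem_Icc_of_mem_stdSimplex (boltzmann_mem_stdSimplex e β) 1)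
    calc _ ≤ 2 * 1 := by
          gcongr
          exact trivial_bound
      _ = 2 / smallScale * smallScale := by
        rw [div_mul_cancel₀ _ smallScale_pos.ne', mul_one]
      _ ≤ errorConstant * ε :=
        mul_le_mul two_div_smallScale_le_errorConstant large smallScale_pos.le
          errorConstant_pos.le

end Thermalization

end Thermalization

end

theorem mainTheorem5 :
    ∃ (C : ℝ) (k : ℕ), 0 < C ∧
      -- Thermalization: the trace distance is `Õ(ε)`.
      (∀ (HS : Matrix (Fin 2) (Fin 2) ℂ) (hHS : HS.IsHermitian) (ρ : Matrix (Fin 2) (Fin 2) ℂ)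
        (Δ β ε σ γ t : ℝ),
        qubitGap hHS = Δ → IsDensityMatrix ρ → Commute ρ HS →
        0 ≤ β → 0 < ε → 0 < σ →
        -- The window `[γ - σ, γ + σ]` contains the gap.
        |Δ - γ| ≤ σ →
        -- `σ ≤ min {ε / (2β), Δ √(ε / 2)}`, with `ε / (2β) = ∞` for `β = 0`.
        2 * β * σ ≤ ε → σ ≤ Δ * √(ε / 2) →
        t ∈ Set.Icc (timeLower Δ σ ε) (timeUpper Δ σ ε) →
        traceNorm (gibbs HS β -
            (channel HS (envHamiltonian γ) (coupling Δ σ t) β t)^[numInteractions Δ γ σ ε t] ρ)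
          ≤ C * ε * (1 + |Real.log ε|) ^ k) ∧
      -- Total simulation time in the limit `σ → 0`, for the smallest admissible `t`.
      (∀ Δ ε : ℝ, 0 < Δ → 0 < ε → ε ≤ 2 → ∀ᶠ σ in 𝓝[>] (0 : ℝ), ∀ γ : ℝ, |Δ - γ| ≤ σ →
        (numInteractions Δ γ σ ε (timeLower Δ σ ε) : ℝ) * timeLower Δ σ ε
          ≤ C * (1 + |Real.log ε|) ^ k / (Δ * ε ^ (2.5 : ℝ))) := by
  refine ⟨errorConstant + 10000000, 1, add_pos errorConstant_pos (by norm_num), ?_, ?_⟩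
  · rintro HS hHS ρ _ β ε σ γ t rfl hρ hc hβ hε hσ hγ hβσ hle ht
    have log_nonneg := abs_nonneg (Real.log ε)
    have C_pos := errorConstant_pos
    calc _ ≤ errorConstant * ε :=
          traceNorm_gibbs_sub_iterate_channel_le hHS hρ hc hβ hβσ
            (isResonant_of_mem_window hε hσ hγ hle ht)
      _ = errorConstant * ε * 1 := by ring
      _ ≤ (errorConstant + 10000000) * ε * (1 + |Real.log ε|) ^ 1 := by
        rw [pow_one]
        gcongr <;> linarith
  · intro Δ ε hΔ hε hε2
    have threshold_pos : 0 < Δ * √(ε / 2) := mul_pos hΔ (Real.sqrt_pos.2 (half_pos hε))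
    filter_upwards [Ioc_mem_nhdsGT threshold_pos] with σ hσ γ hγ
    refine (numInteractions_mul_timeLower_le hε hε2 hσ.1 hσ.2 hγ).trans ?_
    rw [pow_one]
    gcongr
    linarith [errorConstant_pos]
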